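/- Let $I\subset\mathbb{R}$ be a non-degenerate interval (finite or infinite) and let $w$ be a weight function on $I$: $w\ge 0$ is measurable, all moments $\int_I x^k w(x)\,dx$ ($k\in\mathbb{N}$) exist, and if $u\ge 0$ is continuous on $I$ with $\int_I u(x)w(x)\,dx=0$, then $u\equiv 0$ on $I$. Let $\bar A_{\tau,\sigma}$ and $\bar B_\tau, B_\tau, C_\tau$ ($\tau,\sigma\in I$) be measurable real functions. The weighted continuous-stage Runge--Kutta--Nyström (csRKN) method with these coefficients, applied with step size $h$ to $$q''=f(t,q),\qquad q(t_0)=q_0,\quad q'(t_0)=q_0',\qquad f:\mathbb{R}\times\mathbb{R}^d\to\mathbb{R}^d \text{ smooth},$$ is given by $$Q_\tau=q_0+hC_\tau q_0'+h^2\int_I\bar A_{\tau,\sigma}w(\sigma)f(t_0+C_\sigma h,Q_\sigma)\,d\sigma\quad(\tau\in I),$$ $$q_1=q_0+hq_0'+h^2\int_I\bar B_\tau w(\tau)f(t_0+C_\tau h,Q_\tau)\,d\tau,\qquad q_1'=q_0'+h\int_I B_\tau w(\tau)f(t_0+C_\tau h,Q_\tau)\,d\tau .$$ If $I$ is bounded,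 assume that $C$ is bounded, that $\sup_{\tau\in I}\int_I|\bar A_{\tau,\sigma}|w(\sigma)\,d\sigma<\infty$, and that $Bw$ and $\bar Bw$ are integrable on $I$. *Admissible radii.* A function $r$ on $I$ is admissible for the problem if either $I$ is bounded and $r$ is a positive constant, or the following convergence condition holds (it is needed only when $I$ is unbounded): there is a function $\rho$ on $I$ with $0<r\le\rho$ and $\rho\ge 1$ such that $|C_\tau|\le K r(\tau)$ for some constant $K$; for every $k\in\mathbb{N}$ the functions $B\rho^kw$ and $\bar B\rho^kw$ are integrable, each $\sigma\mapsto\bar A_{\tau,\sigma}\rho(\sigma)^kw(\sigma)$ is integrable, and $\int_I|\bar A_{\tau,\sigma}|\rho(\sigma)^kw(\sigma)\,d\sigma\le K_k\,r(\tau)$ for all $\tau\in I$; and for every $k$ there are $K_k',n_k$ with $\|D^kf(t,x)\|\le K_k'\rho(\tau)^{n_k}$ whenever $\tau\in I$, $|t-t_0|\le r(\tau)$ and $\|x-q_0\|\le r(\tau)$. *Order.* The method is of order at least $s$ if for every $d$, every smooth $f$, all initial data, and every admissible $r$: (i) for all sufficiently small $|h|$ the stage equation has exactly one measurable solution $(Q_\tau)_{\tau\in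 I}$ with $\|Q_\tau-q_0\|\le r(\tau)$ for all $\tau\in I$ (for which all integrals above converge); and (ii) with this solution and the exact solution $q$, $$q(t_0+h)-q_1=\mathcal{O}(h^{s+1}),\qquad q'(t_0+h)-q_1'=\mathcal{O}(h^{s+1})\qquad(h\to 0).$$ **Theorem.** Let $p,\eta,\zeta\in\mathbb{N}=\{0,1,2,\dots\}$. Suppose that the csRKN method satisfies the simplifying assumptions (the integrals being absolutely convergent) $$\mathcal{B}(p):\quad \int_IB_\tau w(\tau)C_\tau^{\kappa-1}\,d\tau=\frac1\kappa,\qquad 1\le\kappa\le p,$$ $$\mathcal{CN}(\eta):\quad \int_I\bar A_{\tau,\sigma}w(\sigma)C_\sigma^{\kappa-1}\,d\sigma=\frac{C_\tau^{\kappa+1}}{\kappa(\kappa+1)},\qquad 1\le\kappa\le\eta-1,\ \tau\in I,$$ $$\mathcal{DN}(\zeta):\quad \int_IB_\tau w(\tau)C_\tau^{\kappa-1}\bar A_{\tau,\sigma}\,d\tau=\frac{B_\sigma C_\sigma^{\kappa+1}}{\kappa(\kappa+1)}-\frac{B_\sigma C_\sigma}{\kappa}+\frac{B_\sigma}{\kappa+1},\qquad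 1\le\kappa\le\zeta-1,\ \sigma\in I,$$ and that $\bar B_\tau=B_\tau(1-C_\tau)$ for all $\tau\in I$. Then the method is of order at least $\min\{p,\,2\eta+2,\,\eta+\zeta\}$. -/

import Mathlib

open MeasureTheory Filter Topology Asymptotics
open scoped ContDiff

/-- `w` is a weight function on the interval `I`: it is non-negative, all its moments exist, and a
non-negative (continuous) function whose `w`-weighted integral over `I` vanishes is zero on `I`. -/
structure IsWeightFunction (w : ℝ → ℝ) (I : Set ℝ) : Prop where
  measurable : Measurable w
  nonneg : ∀ x ∈ I, 0 ≤ w x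
  moments : ∀ k : ℕ, IntegrableOn (fun x => x ^ k * w x) I
  definite : ∀ u : ℝ → ℝ, ContinuousOn u I → (∀ x ∈ I, 0 ≤ u x) →
    IntegrableOn (fun x => u x * w x) I → ∫ x in I, u x * w x = 0 → ∀ x ∈ I, u x = 0

/-- The data of a weighted continuous-stage Runge-Kutta-Nyström method: a non-degenerate interval
`I` (bounded or not, open or closed or neither), a weight function on it, and the coefficient
functions. Only the values of the functions on `I` are ever used. -/
structure CsRKN where
  /-- the interval of the stage parameter -/
  I : Set ℝ
  /-- the weight function -/
  w : ℝ → ℝ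
  /-- the coefficient `Ā τ σ` -/
  Abar : ℝ → ℝ → ℝ
  /-- the coefficient of the position update -/
  Bbar : ℝ → ℝ
  /-- the coefficient of the velocity update -/
  B : ℝ → ℝ
  /-- the abscissae -/
  C : ℝ → ℝ
  ordConnected : I.OrdConnected
  nontrivial : I.Nontrivial
  weight : IsWeightFunction w I
  measurable_Abar : Measurable (Function.uncurry Abar)
  measurable_Bbar : Measurable Bbar
  measurable_B : Measurable B
  measurable_C : Measurable C

namespace CsRKN

variable (M : CsRKN)

/-- The simplifying assumption `B(ξ)`. -/
def AssumptionB (ξ : ℕ) : Prop :=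
  ∀ κ : ℕ, 1 ≤ κ → κ ≤ ξ →
    IntegrableOn (fun τ => M.B τ * M.w τ * M.C τ ^ (κ - 1)) M.I ∧
    ∫ τ in M.I, M.B τ * M.w τ * M.C τ ^ (κ - 1) = 1 / (κ : ℝ)

/-- The simplifying assumption `CN(η)` (here `κ + 1 ≤ η` is `κ ≤ η - 1`). -/
def AssumptionCN (η : ℕ) : Prop :=
  ∀ κ : ℕ, 1 ≤ κ → κ + 1 ≤ η → ∀ τ ∈ M.I,
    IntegrableOn (fun σ => M.Abar τ σ * M.w σ * M.C σ ^ (κ - 1)) M.I ∧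
    ∫ σ in M.I, M.Abar τ σ * M.w σ * M.C σ ^ (κ - 1)
      = M.C τ ^ (κ + 1) / ((κ : ℝ) * ((κ : ℝ) + 1))

/-- The simplifying assumption `DN(ζ)` (here `κ + 1 ≤ ζ` is `κ ≤ ζ - 1`). -/
def AssumptionDN (ζ : ℕ) : Prop :=
  ∀ κ : ℕ, 1 ≤ κ → κ + 1 ≤ ζ → ∀ σ ∈ M.I,
    IntegrableOn (fun τ => M.B τ * M.w τ * M.C τ ^ (κ - 1) * M.Abar τ σ) M.I ∧
    ∫ τ in M.I, M.B τ * M.w τ * M.C τ ^ (κ - 1) * M.Abar τ σ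
      = M.B σ * M.C σ ^ (κ + 1) / ((κ : ℝ) * ((κ : ℝ) + 1)) - M.B σ * M.C σ / (κ : ℝ)
        + M.B σ / ((κ : ℝ) + 1)

/-- The coefficients are uniformly summable: `C` is bounded, the integrals of `|Ā τ ·| w` are
bounded uniformly in `τ`, and `B w` and `B̄ w` are integrable. Bounded measurable coefficients
(for instance continuous ones on a compact interval) always have this property. -/
structure UniformlyIntegrableCoefficients : Prop where
  bounded_C : ∃ K : ℝ, ∀ τ ∈ M.I, |M.C τ| ≤ K
  integrable_Abar : ∀ τ ∈ M.I, IntegrableOn (fun σ => M.Abar τ σ * M.w σ) M.I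
  bounded_Abar : ∃ K : ℝ, ∀ τ ∈ M.I, ∫ σ in M.I, |M.Abar τ σ * M.w σ| ≤ K
  integrable_B : IntegrableOn (fun τ => M.B τ * M.w τ) M.I
  integrable_Bbar : IntegrableOn (fun τ => M.Bbar τ * M.w τ) M.I

/-- For the problem `q'' = f (t, q)`, `q t₀ = q₀`, `q' t₀ = q'₀` and the step size `h`, the function
`Q` on `I` is a solution of the stage equation of the method; all integrals of the method
converge. -/
structure IsStageSolution {d : ℕ}
    (f : ℝ × EuclideanSpace ℝ (Fin d) → EuclideanSpace ℝ (Fin d)) (t₀ : ℝ)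
    (q₀ q'₀ : EuclideanSpace ℝ (Fin d)) (h : ℝ) (Q : ℝ → EuclideanSpace ℝ (Fin d)) : Prop where
  aestronglyMeasurable : AEStronglyMeasurable Q (volume.restrict M.I)
  integrable_Abar : ∀ τ ∈ M.I,
    IntegrableOn (fun σ => (M.Abar τ σ * M.w σ) • f (t₀ + M.C σ * h, Q σ)) M.I
  integrable_Bbar : IntegrableOn (fun τ => (M.Bbar τ * M.w τ) • f (t₀ + M.C τ * h, Q τ)) M.I
  integrable_B : IntegrableOn (fun τ => (M.B τ * M.w τ) • f (t₀ + M.C τ * h, Q τ)) M.I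
  stage_eq : ∀ τ ∈ M.I, Q τ = q₀ + (h * M.C τ) • q'₀
    + h ^ 2 • ∫ σ in M.I, (M.Abar τ σ * M.w σ) • f (t₀ + M.C σ * h, Q σ)

/-- The numerical position `q₁` after one step of size `h`, computed from the stages `Q`. -/
noncomputable def stepPosition {d : ℕ}
    (f : ℝ × EuclideanSpace ℝ (Fin d) → EuclideanSpace ℝ (Fin d)) (t₀ : ℝ)
    (q₀ q'₀ : EuclideanSpace ℝ (Fin d)) (h : ℝ) (Q : ℝ → EuclideanSpace ℝ (Fin d)) :
    EuclideanSpace ℝ (Fin d) :=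
  q₀ + h • q'₀ + h ^ 2 • ∫ τ in M.I, (M.Bbar τ * M.w τ) • f (t₀ + M.C τ * h, Q τ)

/-- The numerical velocity `q'₁` after one step of size `h`, computed from the stages `Q`. -/
noncomputable def stepVelocity {d : ℕ}
    (f : ℝ × EuclideanSpace ℝ (Fin d) → EuclideanSpace ℝ (Fin d)) (t₀ : ℝ)
    (q'₀ : EuclideanSpace ℝ (Fin d)) (h : ℝ) (Q : ℝ → EuclideanSpace ℝ (Fin d)) :
    EuclideanSpace ℝ (Fin d) :=
  q'₀ + h • ∫ τ in M.I, (M.B τ * M.w τ) • f (t₀ + M.C τ * h, Q τ)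

/-- The convergence condition which makes all integrals of the method converge uniformly for small
`h`, together with all their formal derivatives in `h`: the derivatives of `f` of each order are
dominated, on the tube of radius `r τ` around `(t₀, q₀)`, by a power of `ρ τ`, and the integrals
with these majorants converge, those over `Ā τ ·` being `O(r τ)`.
(On the whole line, with a Gaussian weight and polynomial coefficients, this holds for every `f` all
of whose derivatives have polynomial growth, with `r = ρ` a power of `1 + |τ|`.) -/
structure IsDominated {d : ℕ}
    (f : ℝ × EuclideanSpace ℝ (Fin d) → EuclideanSpace ℝ (Fin d)) (t₀ : ℝ)
    (q₀ : EuclideanSpace ℝ (Fin d)) (r ρ : ℝ → ℝ) : Prop where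
  radius_pos : ∀ τ ∈ M.I, 0 < r τ
  radius_le : ∀ τ ∈ M.I, r τ ≤ ρ τ
  one_le : ∀ τ ∈ M.I, 1 ≤ ρ τ
  bound_C : ∃ K : ℝ, ∀ τ ∈ M.I, |M.C τ| ≤ K * r τ
  integrable_Abar : ∀ k : ℕ, ∀ τ ∈ M.I,
    IntegrableOn (fun σ => M.Abar τ σ * M.w σ * ρ σ ^ k) M.I
  bound_Abar : ∀ k : ℕ, ∃ K : ℝ, ∀ τ ∈ M.I,
    ∫ σ in M.I, |M.Abar τ σ * M.w σ * ρ σ ^ k| ≤ K * r τ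
  integrable_B : ∀ k : ℕ, IntegrableOn (fun τ => M.B τ * M.w τ * ρ τ ^ k) M.I
  integrable_Bbar : ∀ k : ℕ, IntegrableOn (fun τ => M.Bbar τ * M.w τ * ρ τ ^ k) M.I
  bound_f : ∀ k : ℕ, ∃ (K : ℝ) (n : ℕ), ∀ τ ∈ M.I, ∀ (t : ℝ) (x : EuclideanSpace ℝ (Fin d)),
    |t - t₀| ≤ r τ → ‖x - q₀‖ ≤ r τ → ‖iteratedFDeriv ℝ k f (t, x)‖ ≤ K * ρ τ ^ n

/-- The radii of the tubes around `q₀` in which the stages are sought. If `I` is bounded, every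
positive constant is allowed; a general radius function is allowed under the convergence condition
`IsDominated`, which is needed only when `I` is unbounded. -/
def IsAdmissibleRadius {d : ℕ}
    (f : ℝ × EuclideanSpace ℝ (Fin d) → EuclideanSpace ℝ (Fin d)) (t₀ : ℝ)
    (q₀ : EuclideanSpace ℝ (Fin d)) (r : ℝ → ℝ) : Prop :=
  (Bornology.IsBounded M.I ∧ ∃ R : ℝ, 0 < R ∧ ∀ τ ∈ M.I, r τ = R) ∨
    ∃ ρ : ℝ → ℝ, M.IsDominated f t₀ q₀ r ρ

/-- The method is of order (at least) `s`: for every smooth problem with exact solution `q` (and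
velocity `q'`) near `t₀` and every admissible tube, the stage equation has, for all small `h`,
exactly one solution in the tube, and the local errors are `O(h ^ (s + 1))`. -/
def HasOrder (s : ℕ) : Prop :=
  ∀ (d : ℕ) (f : ℝ × EuclideanSpace ℝ (Fin d) → EuclideanSpace ℝ (Fin d)) (t₀ : ℝ)
    (q₀ q'₀ : EuclideanSpace ℝ (Fin d)) (q q' : ℝ → EuclideanSpace ℝ (Fin d)) (r : ℝ → ℝ),
    ContDiff ℝ ∞ f →
    q t₀ = q₀ → q' t₀ = q'₀ →
    (∀ᶠ t in 𝓝 t₀, HasDerivAt q (q' t) t ∧ HasDerivAt q' (f (t, q t)) t) →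
    M.IsAdmissibleRadius f t₀ q₀ r →
    (∀ᶠ h in 𝓝 (0 : ℝ), ∃ Q : ℝ → EuclideanSpace ℝ (Fin d),
      M.IsStageSolution f t₀ q₀ q'₀ h Q ∧ (∀ τ ∈ M.I, ‖Q τ - q₀‖ ≤ r τ) ∧
      ∀ Q' : ℝ → EuclideanSpace ℝ (Fin d), M.IsStageSolution f t₀ q₀ q'₀ h Q' →
        (∀ τ ∈ M.I, ‖Q' τ - q₀‖ ≤ r τ) → Set.EqOn Q' Q M.I) ∧
    (∀ Q : ℝ → ℝ → EuclideanSpace ℝ (Fin d),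
      (∀ᶠ h in 𝓝 (0 : ℝ),
        M.IsStageSolution f t₀ q₀ q'₀ h (Q h) ∧ ∀ τ ∈ M.I, ‖Q h τ - q₀‖ ≤ r τ) →
      (fun h : ℝ => q (t₀ + h) - M.stepPosition f t₀ q₀ q'₀ h (Q h))
          =O[𝓝 0] (fun h : ℝ => h ^ (s + 1)) ∧
      (fun h : ℝ => q' (t₀ + h) - M.stepVelocity f t₀ q'₀ h (Q h))
          =O[𝓝 0] (fun h : ℝ => h ^ (s + 1)))

end CsRKN

/-! Extend the exact solution to a function `x` of elapsed time, and compare the stages with `x (C τ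
h)`. Write `E` for the stage errors, `G` for `f` along the exact solution, `Y` for the difference
between `f` at the stages and `G`, and `X` for `x - q₀ - s q'₀` at `s = C τ h`. The stage equation
becomes `E = h² ∫ Ā w (Y + G) - X`. Put `e = η - 1` and `z = ζ - 1`.

Size of `E`. By `CN` the Taylor terms of `h² ∫ Ā w G` and of `X` cancel below order `e + 2`. Since
`Y` is Lipschitz in `E`, feeding a bound for `E` back into the equation improves it, until `E = O(h
^ (e + 2))` (`domO_stage_error`).

Reduction to moments. By `B(p)` and `B̄ = B (1 - C)`, the update formulas applied to `G` alone
reproduce the Taylor series of `q` and `q'` with error `O(h ^ (p + 1))`. What remains are the terms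
`h ∫ B w Y` and `h² ∫ B w (1 - C) Y`. Linearizing `f` and expanding its Jacobian along the solution
gives `Y = ∑_{i < z} (C h)^i J_i E`, up to `O(h ^ (2e + 4))` from the quadratic remainder and `O(h ^
(e + z + 2))` from the truncation. So it is enough that `h^a ∫ B w C^l E = O(h ^ (s + 1))` whenever
`l < a`.

Moments of `E` (`isBigO_moment`). If `a > z`, the size of `E` suffices. Otherwise `l + 1 ≤ z`;
insert the equation for `E`, interchange the integrals, and apply `DN` with `κ = l + 1`. This
replaces `C^l ∫ Ā` by the polynomial `φ(c) = ∫_c^1 t^l (t - c) dt`. The terms in `G` and `X` form a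
quadrature error of an identity true for exact integrals, hence are small by `B(p)`. The terms in
`Y` carry two more powers of `h` and expand again into moments of `E` with larger `a` and still `l <
a`, so a descending induction on `a` closes.

All estimates must be uniform in `τ` even when `I` and `C` are unbounded. Hence orders in `h` are
taken up to powers of `ρ`, a class stable under products and under integration against `Ā w`. -/

namespace CsRKN

/-! ### Calculus of orders in `h` up to powers of `ρ`. -/

section Dominated

variable {M : CsRKN} {ρ : ℝ → ℝ}
  {V : Type*} [NormedAddCommGroup V] {W : Type*} [NormedAddCommGroup W]

/-- `F h τ` is measurable in `τ` and, uniformly in `τ ∈ I`, of order `h ^ N` as `h → 0`, up to a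
power of `ρ τ`. -/
def DomO (M : CsRKN) (ρ : ℝ → ℝ) (N : ℕ) (F : ℝ → ℝ → V) : Prop :=
  (∀ᶠ h in 𝓝 (0 : ℝ), AEStronglyMeasurable (F h) (volume.restrict M.I)) ∧
  ∃ (K : ℝ) (n : ℕ), ∀ᶠ h in 𝓝 (0 : ℝ), ∀ τ ∈ M.I, ‖F h τ‖ ≤ K * |h| ^ N * ρ τ ^ n

theorem measurableSet_I (M : CsRKN) : MeasurableSet M.I := M.ordConnected.measurableSet

/-- Comparison principle: losing a fixed power of `ρ` is free. This is how Lipschitz and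
linearization bounds, whose constants grow like powers of `ρ`, enter. -/
theorem DomO.of_bound (h1 : ∀ τ ∈ M.I, 1 ≤ ρ τ) {N : ℕ} {F : ℝ → ℝ → V} {G : ℝ → ℝ → W}
    (hG : M.DomO ρ N G)
    (hF : ∀ᶠ h in 𝓝 (0 : ℝ), AEStronglyMeasurable (F h) (volume.restrict M.I))
    {K : ℝ} {n : ℕ} (hFG : ∀ᶠ h in 𝓝 (0 : ℝ), ∀ τ ∈ M.I, ‖F h τ‖ ≤ K * ρ τ ^ n * ‖G h τ‖) :
    M.DomO ρ N F := by
  obtain ⟨-, L, m, hL⟩ := hG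
  refine ⟨hF, |K| * L, n + m, ?_⟩
  filter_upwards [hL, hFG] with h hL hFG τ hτ
  have hρ := h1 τ hτ
  calc ‖F h τ‖ ≤ K * ρ τ ^ n * ‖G h τ‖ := hFG τ hτ
    _ ≤ |K| * ρ τ ^ n * ‖G h τ‖ := by gcongr; exact le_abs_self K
    _ ≤ |K| * ρ τ ^ n * (L * |h| ^ N * ρ τ ^ m) := by gcongr; exact hL τ hτ
    _ = _ := by ring

theorem DomO.congr {N : ℕ} {F G : ℝ → ℝ → V} (hF : M.DomO ρ N F)
    (hFG : ∀ᶠ h in 𝓝 (0 : ℝ), ∀ τ ∈ M.I, F h τ = G h τ) : M.DomO ρ N G := by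
  obtain ⟨hm, K, n, hK⟩ := hF
  refine ⟨?_, K, n, ?_⟩
  · filter_upwards [hm, hFG] with h hm hFG
    exact hm.congr ((ae_restrict_iff' M.measurableSet_I).2 (Eventually.of_forall hFG))
  · filter_upwards [hK, hFG] with h hK hFG τ hτ
    rw [← hFG τ hτ]; exact hK τ hτ

theorem DomO.mono (h1 : ∀ τ ∈ M.I, 1 ≤ ρ τ) {N N' : ℕ} (hN : N' ≤ N) {F : ℝ → ℝ → V}
    (hF : M.DomO ρ N F) : M.DomO ρ N' F := by
  obtain ⟨hm, K, n, hK⟩ := hF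
  refine ⟨hm, |K|, n, ?_⟩
  have : ∀ᶠ h in 𝓝 (0 : ℝ), |h| < 1 := by
    have := Metric.ball_mem_nhds (0 : ℝ) one_pos
    filter_upwards [this] with h hh
    simpa using hh
  filter_upwards [hK, this] with h hK hh τ hτ
  have hρ := h1 τ hτ
  calc ‖F h τ‖ ≤ K * |h| ^ N * ρ τ ^ n := hK τ hτ
    _ ≤ |K| * |h| ^ N' * ρ τ ^ n := by
      gcongr ?_ * ?_ * _
      · exact le_abs_self K
      · exact pow_le_pow_of_le_one (abs_nonneg h) hh.le hN

theorem DomO.add (h1 : ∀ τ ∈ M.I, 1 ≤ ρ τ) {N : ℕ} {F G : ℝ → ℝ → V}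
    (hF : M.DomO ρ N F) (hG : M.DomO ρ N G) : M.DomO ρ N fun h τ => F h τ + G h τ := by
  obtain ⟨hm, K, n, hK⟩ := hF
  obtain ⟨hm', K', n', hK'⟩ := hG
  refine ⟨?_, |K| + |K'|, n + n', ?_⟩
  · filter_upwards [hm, hm'] with h hm hm' using hm.add hm'
  · filter_upwards [hK, hK'] with h hK hK' τ hτ
    have hρ := h1 τ hτ
    calc ‖F h τ + G h τ‖ ≤ K * |h| ^ N * ρ τ ^ n + K' * |h| ^ N * ρ τ ^ n' :=
          (norm_add_le _ _).trans (add_le_add (hK τ hτ) (hK' τ hτ))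
      _ ≤ |K| * |h| ^ N * ρ τ ^ (n + n') + |K'| * |h| ^ N * ρ τ ^ (n + n') := by
          gcongr ?_ * _ * ?_ + ?_ * _ * ?_
          · exact le_abs_self K
          · exact pow_le_pow_right₀ hρ (by omega)
          · exact le_abs_self K'
          · exact pow_le_pow_right₀ hρ (by omega)
      _ = _ := by ring

variable [NormedSpace ℝ V] [NormedSpace ℝ W]

theorem DomO.smul {N N' : ℕ} {a : ℝ → ℝ → ℝ} {F : ℝ → ℝ → V}
    (ha : M.DomO ρ N a) (hF : M.DomO ρ N' F) : M.DomO ρ (N + N') fun h τ => a h τ • F h τ := by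
  obtain ⟨hm, K, n, hK⟩ := ha
  obtain ⟨hm', K', n', hK'⟩ := hF
  refine ⟨?_, K * K', n + n', ?_⟩
  · filter_upwards [hm, hm'] with h hm hm' using hm.smul hm'
  · filter_upwards [hK, hK'] with h hK hK' τ hτ
    rw [norm_smul]
    calc ‖a h τ‖ * ‖F h τ‖ ≤ (K * |h| ^ N * ρ τ ^ n) * (K' * |h| ^ N' * ρ τ ^ n') :=
          mul_le_mul (hK τ hτ) (hK' τ hτ) (norm_nonneg _) ((norm_nonneg _).trans (hK τ hτ))
      _ = _ := by ring

theorem DomO.mul {N N' : ℕ} {a b : ℝ → ℝ → ℝ}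
    (ha : M.DomO ρ N a) (hb : M.DomO ρ N' b) : M.DomO ρ (N + N') fun h τ => a h τ * b h τ :=
  ha.smul hb

theorem DomO.clm_apply {N N' : ℕ} {A : ℝ → ℝ → V →L[ℝ] W} {F : ℝ → ℝ → V}
    (hA : M.DomO ρ N A) (hF : M.DomO ρ N' F) : M.DomO ρ (N + N') fun h τ => A h τ (F h τ) := by
  obtain ⟨hm, K, n, hK⟩ := hA
  obtain ⟨hm', K', n', hK'⟩ := hF
  refine ⟨?_, K * K', n + n', ?_⟩
  · filter_upwards [hm, hm'] with h hm hm'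
    exact (ContinuousLinearMap.flip (ContinuousLinearMap.apply ℝ W)).aestronglyMeasurable_comp₂ hm hm'
  · filter_upwards [hK, hK'] with h hK hK' τ hτ
    refine ((A h τ).le_opNorm _).trans ?_
    calc ‖A h τ‖ * ‖F h τ‖ ≤ (K * |h| ^ N * ρ τ ^ n) * (K' * |h| ^ N' * ρ τ ^ n') :=
          mul_le_mul (hK τ hτ) (hK' τ hτ) (norm_nonneg _) ((norm_nonneg _).trans (hK τ hτ))
      _ = _ := by ring

theorem domO_const {N : ℕ} (v : V) : M.DomO ρ N fun h _ => h ^ N • v := by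
  refine ⟨Eventually.of_forall fun h => aestronglyMeasurable_const, ‖v‖, 0,
    Eventually.of_forall fun h τ _ => ?_⟩
  simp [norm_smul, mul_comm]

theorem domO_pow (N : ℕ) : M.DomO ρ N fun h _ => h ^ N := by
  simpa using domO_const (M := M) (ρ := ρ) (N := N) (1 : ℝ)

theorem domO_vec (v : V) : M.DomO ρ 0 fun _ _ => v := by
  simpa using domO_const (M := M) (ρ := ρ) (N := 0) v

theorem domO_zero {N : ℕ} : M.DomO ρ N fun _ _ => (0 : V) := by
  simpa using domO_const (M := M) (ρ := ρ) (N := N) (0 : V)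

theorem DomO.const_smul {N : ℕ} {F : ℝ → ℝ → V} (c : ℝ)
    (hF : M.DomO ρ N F) : M.DomO ρ N fun h τ => c • F h τ := by
  simpa using (domO_vec (M := M) (ρ := ρ) c).smul hF

theorem DomO.pow_smul {N : ℕ} {F : ℝ → ℝ → V} (k : ℕ)
    (hF : M.DomO ρ N F) : M.DomO ρ (k + N) fun h τ => h ^ k • F h τ :=
  (domO_pow k).smul hF

theorem DomO.sub (h1 : ∀ τ ∈ M.I, 1 ≤ ρ τ) {N : ℕ} {F G : ℝ → ℝ → V}
    (hF : M.DomO ρ N F) (hG : M.DomO ρ N G) : M.DomO ρ N fun h τ => F h τ - G h τ := by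
  simpa [sub_eq_add_neg] using hF.add h1 (hG.const_smul (-1))

theorem DomO.sum (h1 : ∀ τ ∈ M.I, 1 ≤ ρ τ) {N : ℕ} {ι : Type*} (s : Finset ι)
    {F : ι → ℝ → ℝ → V} (hF : ∀ i ∈ s, M.DomO ρ N (F i)) :
    M.DomO ρ N fun h τ => ∑ i ∈ s, F i h τ := by
  classical
  induction s using Finset.induction_on with
  | empty => simpa using domO_zero
  | insert a s ha ih =>
    have := (hF a (by simp)).add h1 (ih fun i hi => hF i (by simp [hi]))
    refine this.congr (Eventually.of_forall fun h τ _ => ?_)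
    rw [Finset.sum_insert ha]

end Dominated

/-! ### Integration against `Ā w` and `B w`, and Fubini. -/

section Integrals

variable {M : CsRKN} {d : ℕ} {f : ℝ × EuclideanSpace ℝ (Fin d) → EuclideanSpace ℝ (Fin d)}
  {t₀ : ℝ} {q₀ : EuclideanSpace ℝ (Fin d)} {r ρ : ℝ → ℝ}
  {V : Type*} [NormedAddCommGroup V] [NormedSpace ℝ V]

theorem IsDominated.domO_C (hD : M.IsDominated f t₀ q₀ r ρ) : M.DomO ρ 0 fun _ τ => M.C τ := by
  obtain ⟨K, hK⟩ := hD.bound_C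
  refine ⟨Eventually.of_forall fun h => M.measurable_C.aestronglyMeasurable, |K|, 1,
    Eventually.of_forall fun h τ hτ => ?_⟩
  have h1 := hD.radius_pos τ hτ
  have h2 := hD.radius_le τ hτ
  calc ‖M.C τ‖ ≤ K * r τ := hK τ hτ
    _ ≤ |K| * ρ τ := by gcongr; exact le_abs_self K
    _ = _ := by simp

theorem IsDominated.domO_C_pow (hD : M.IsDominated f t₀ q₀ r ρ) (k : ℕ) :
    M.DomO ρ 0 fun _ τ => M.C τ ^ k := by
  induction k with
  | zero => simpa using domO_vec (M := M) (ρ := ρ) (1 : ℝ)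
  | succ k ih => simpa [pow_succ] using ih.mul hD.domO_C

/-- A function bounded by a power of `ρ` is integrable against a kernel integrable against all
powers of `ρ`. -/
theorem integrableOn_smul_of_le_pow {a : ℝ → ℝ} {F : ℝ → V} {K : ℝ} {n : ℕ}
    (ha : AEStronglyMeasurable a (volume.restrict M.I))
    (hF : AEStronglyMeasurable F (volume.restrict M.I))
    (hint : IntegrableOn (fun σ => a σ * ρ σ ^ n) M.I)
    (h1 : ∀ τ ∈ M.I, 1 ≤ ρ τ) (hK : ∀ σ ∈ M.I, ‖F σ‖ ≤ K * ρ σ ^ n) :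
    IntegrableOn (fun σ => a σ • F σ) M.I ∧
      ‖∫ σ in M.I, a σ • F σ‖ ≤ K * ∫ σ in M.I, |a σ * ρ σ ^ n| ∧
      ∫ σ in M.I, ‖a σ • F σ‖ ≤ K * ∫ σ in M.I, |a σ * ρ σ ^ n| := by
  have hb : ∀ᵐ σ ∂volume.restrict M.I, ‖a σ • F σ‖ ≤ K * |a σ * ρ σ ^ n| := by
    refine (ae_restrict_iff' M.measurableSet_I).2 (Eventually.of_forall fun σ hσ => ?_)
    have h2 : 0 ≤ ρ σ ^ n := by have := h1 σ hσ; positivity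
    rw [norm_smul, abs_mul, abs_of_nonneg h2, Real.norm_eq_abs]
    calc |a σ| * ‖F σ‖ ≤ |a σ| * (K * ρ σ ^ n) := by gcongr; exact hK σ hσ
      _ = _ := by ring
  have hi : Integrable (fun σ => K * |a σ * ρ σ ^ n|) (volume.restrict M.I) :=
    (Integrable.abs hint).const_mul K
  have h3 : Integrable (fun σ => a σ • F σ) (volume.restrict M.I) := hi.mono' (ha.smul hF) hb
  refine ⟨h3, ?_, ?_⟩
  · rw [← integral_const_mul]; exact norm_integral_le_of_norm_le hi hb
  · rw [← integral_const_mul]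
    exact integral_mono_ae h3.norm hi hb

theorem measurable_w (M : CsRKN) : Measurable M.w := M.weight.measurable

theorem measurable_Abar_right (M : CsRKN) (τ : ℝ) : Measurable fun σ => M.Abar τ σ * M.w σ :=
  (M.measurable_Abar.comp measurable_prodMk_left).mul M.measurable_w

theorem measurable_B_w (M : CsRKN) : Measurable fun σ => M.B σ * M.w σ :=
  M.measurable_B.mul M.measurable_w

theorem aestronglyMeasurable_integral_Abar {F : ℝ → V}
    (hF : AEStronglyMeasurable F (volume.restrict M.I)) (μ : Measure ℝ) [SFinite μ] :
    AEStronglyMeasurable (fun τ => ∫ σ in M.I, (M.Abar τ σ * M.w σ) • F σ) μ := by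
  have h1 : AEStronglyMeasurable (fun z : ℝ × ℝ => (M.Abar z.1 z.2 * M.w z.2) • F z.2)
      (μ.prod (volume.restrict M.I)) :=
    ((M.measurable_Abar.mul (M.measurable_w.comp measurable_snd)).aestronglyMeasurable).smul
      hF.comp_snd
  exact h1.integral_prod_right'

/-- The constant `L` depends only on `n`, and the result is measured by `r` rather than by a power
of `ρ`. Both are needed for the fixed-point argument in the tube of radius `r`. -/
theorem IsDominated.integral_Abar_le (hD : M.IsDominated f t₀ q₀ r ρ) (n : ℕ) :
    ∃ L : ℝ, 0 ≤ L ∧ ∀ (F : ℝ → V) (K : ℝ), 0 ≤ K →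
      AEStronglyMeasurable F (volume.restrict M.I) →
      (∀ σ ∈ M.I, ‖F σ‖ ≤ K * ρ σ ^ n) → ∀ τ ∈ M.I,
      IntegrableOn (fun σ => (M.Abar τ σ * M.w σ) • F σ) M.I ∧
      ‖∫ σ in M.I, (M.Abar τ σ * M.w σ) • F σ‖ ≤ K * L * r τ ∧
      ∫ σ in M.I, ‖(M.Abar τ σ * M.w σ) • F σ‖ ≤ K * L * r τ := by
  obtain ⟨L, hL⟩ := hD.bound_Abar n
  refine ⟨|L|, abs_nonneg L, fun F K hK0 hF hK τ hτ => ?_⟩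
  obtain ⟨h1, h2, h3⟩ := integrableOn_smul_of_le_pow
    (M.measurable_Abar_right τ).aestronglyMeasurable hF (hD.integrable_Abar n τ hτ) hD.one_le hK
  have h4 : K * ∫ σ in M.I, |M.Abar τ σ * M.w σ * ρ σ ^ n| ≤ K * |L| * r τ := by
    have := hD.radius_pos τ hτ
    rw [mul_assoc]
    gcongr
    exact (hL τ hτ).trans (by gcongr; exact le_abs_self L)
  exact ⟨h1, h2.trans h4, h3.trans h4⟩

/-- Whatever power of `ρ` bounds `F`, the kernel absorbs it and returns `r ≤ ρ`; so the stage
operator can be iterated without losing the order in `h`. -/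
theorem IsDominated.domO_integral_Abar (hD : M.IsDominated f t₀ q₀ r ρ) {N : ℕ}
    {F : ℝ → ℝ → V} (hF : M.DomO ρ N F) :
    M.DomO ρ N fun h τ => ∫ σ in M.I, (M.Abar τ σ * M.w σ) • F h σ := by
  obtain ⟨hm, K, n, hK⟩ := hF
  obtain ⟨L, hL0, hL⟩ := hD.integral_Abar_le (V := V) n
  refine ⟨?_, |K| * L, 1, ?_⟩
  · filter_upwards [hm] with h hm using aestronglyMeasurable_integral_Abar hm _
  · filter_upwards [hm, hK] with h hm hK τ hτ
    have hr := hD.radius_le τ hτ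
    refine ((hL (F h) (|K| * |h| ^ N) (by positivity) hm (fun σ hσ => (hK σ hσ).trans ?_)
      τ hτ).2.1).trans ?_
    · have := hD.one_le σ hσ
      gcongr; exact le_abs_self K
    · calc |K| * |h| ^ N * L * r τ ≤ |K| * |h| ^ N * L * ρ τ := by gcongr
        _ = _ := by ring

theorem IsDominated.integrable_Abar_smul (hD : M.IsDominated f t₀ q₀ r ρ) {N : ℕ}
    {F : ℝ → ℝ → V} (hF : M.DomO ρ N F) : ∀ᶠ h in 𝓝 (0 : ℝ), ∀ τ ∈ M.I,
      IntegrableOn (fun σ => (M.Abar τ σ * M.w σ) • F h σ) M.I := by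
  obtain ⟨hm, K, n, hK⟩ := hF
  filter_upwards [hm, hK] with h hm hK τ hτ
  exact (integrableOn_smul_of_le_pow (M.measurable_Abar_right τ).aestronglyMeasurable hm
    (hD.integrable_Abar n τ hτ) hD.one_le hK).1

theorem IsDominated.integrable_B_smul (hD : M.IsDominated f t₀ q₀ r ρ) {N : ℕ}
    {F : ℝ → ℝ → V} (hF : M.DomO ρ N F) : ∀ᶠ h in 𝓝 (0 : ℝ),
      Integrable (fun τ => (M.B τ * M.w τ) • F h τ) (volume.restrict M.I) := by
  obtain ⟨hm, K, n, hK⟩ := hF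
  filter_upwards [hm, hK] with h hm hK
  exact (integrableOn_smul_of_le_pow M.measurable_B_w.aestronglyMeasurable hm
    (hD.integrable_B n) hD.one_le hK).1

theorem IsDominated.isBigO_integral_B (hD : M.IsDominated f t₀ q₀ r ρ) {N : ℕ}
    {F : ℝ → ℝ → V} (hF : M.DomO ρ N F) :
    (fun h => ∫ τ in M.I, (M.B τ * M.w τ) • F h τ) =O[𝓝 0] fun h : ℝ => h ^ N := by
  obtain ⟨hm, K, n, hK⟩ := hF
  refine IsBigO.of_bound (K * ∫ σ in M.I, |M.B σ * M.w σ * ρ σ ^ n|) ?_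
  filter_upwards [hm, hK] with h hm hK
  refine (integrableOn_smul_of_le_pow M.measurable_B_w.aestronglyMeasurable hm
    (hD.integrable_B n) hD.one_le hK).2.1.trans (le_of_eq ?_)
  rw [norm_pow, Real.norm_eq_abs]; ring

/-- The interchange of the two integrations behind the assumption `DN`. -/
theorem IsDominated.integral_B_integral_Abar [CompleteSpace V] (hD : M.IsDominated f t₀ q₀ r ρ) {ζ : ℕ}
    (hDN : M.AssumptionDN ζ) {κ : ℕ} (hκ : 1 ≤ κ) (hκζ : κ + 1 ≤ ζ) {F : ℝ → V} {K : ℝ} {n : ℕ}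
    (hF : AEStronglyMeasurable F (volume.restrict M.I)) (hK : ∀ σ ∈ M.I, ‖F σ‖ ≤ K * ρ σ ^ n) :
    ∫ τ in M.I, (M.B τ * M.w τ) • (M.C τ ^ (κ - 1) • ∫ σ in M.I, (M.Abar τ σ * M.w σ) • F σ)
      = ∫ σ in M.I, (M.B σ * M.w σ) • ((M.C σ ^ (κ + 1) / ((κ : ℝ) * ((κ : ℝ) + 1))
          - M.C σ / (κ : ℝ) + 1 / ((κ : ℝ) + 1)) • F σ) := by
  obtain ⟨L, hL0, hL⟩ := hD.integral_Abar_le (V := V) n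
  have hKF : ∀ σ ∈ M.I, ‖F σ‖ ≤ |K| * ρ σ ^ n := fun σ hσ => (hK σ hσ).trans <| by
    have := hD.one_le σ hσ
    gcongr; exact le_abs_self K
  have hmB : Measurable fun τ => M.B τ * M.w τ * M.C τ ^ (κ - 1) :=
    M.measurable_B_w.mul (M.measurable_C.pow_const _)
  have hmeas : AEStronglyMeasurable (fun z : ℝ × ℝ => (M.B z.1 * M.w z.1 * M.C z.1 ^ (κ - 1)) •
      ((M.Abar z.1 z.2 * M.w z.2) • F z.2))
      ((volume.restrict M.I).prod (volume.restrict M.I)) :=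
    (hmB.comp measurable_fst).aestronglyMeasurable.smul
      (((M.measurable_Abar.mul (M.measurable_w.comp measurable_snd)).aestronglyMeasurable).smul
        hF.comp_snd)
  have hint : Integrable (Function.uncurry fun τ σ => (M.B τ * M.w τ * M.C τ ^ (κ - 1)) •
      ((M.Abar τ σ * M.w σ) • F σ)) ((volume.restrict M.I).prod (volume.restrict M.I)) := by
    refine (integrable_prod_iff hmeas).2 ⟨?_, ?_⟩
    · refine (ae_restrict_iff' M.measurableSet_I).2 (Eventually.of_forall fun τ hτ => ?_)
      exact Integrable.smul (M.B τ * M.w τ * M.C τ ^ (κ - 1))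
        (hL F |K| (abs_nonneg K) hF hKF τ hτ).1
    -- The inner integral of norms is at most a constant times `r ≤ ρ`, and `C ^ (κ - 1)` costs `ρ ^
    -- m`, hence the majorant `|B w| ρ ^ (m + 1)`.
    · obtain ⟨-, c, m, hc⟩ := hD.domO_C_pow (κ - 1)
      obtain ⟨h, hc⟩ := hc.exists
      have hi : Integrable (fun τ => |c| * (|K| * L) * |M.B τ * M.w τ * ρ τ ^ (m + 1)|)
          (volume.restrict M.I) := (Integrable.abs (hD.integrable_B (m + 1))).const_mul _
      refine hi.mono' hmeas.norm.integral_prod_right'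
        ((ae_restrict_iff' M.measurableSet_I).2 (Eventually.of_forall fun τ hτ => ?_))
      have hρ := hD.one_le τ hτ
      have hr := hD.radius_le τ hτ
      have hr0 := hD.radius_pos τ hτ
      rw [Real.norm_of_nonneg (integral_nonneg fun _ => norm_nonneg _)]
      simp_rw [norm_smul (M.B τ * M.w τ * M.C τ ^ (κ - 1))]
      rw [integral_const_mul]
      have h5 : ‖M.C τ ^ (κ - 1)‖ ≤ |c| * ρ τ ^ m := (hc τ hτ).trans <| by
        rw [pow_zero, mul_one]; gcongr; exact le_abs_self c
      have hρ' : |ρ τ ^ (m + 1)| = ρ τ ^ m * ρ τ := by rw [abs_of_nonneg (by positivity), pow_succ]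
      calc ‖M.B τ * M.w τ * M.C τ ^ (κ - 1)‖ * ∫ σ in M.I, ‖(M.Abar τ σ * M.w σ) • F σ‖
          ≤ ‖M.B τ * M.w τ‖ * (|c| * ρ τ ^ m) * (|K| * L * r τ) := by
            rw [norm_mul]
            gcongr
            exact (hL F |K| (abs_nonneg K) hF hKF τ hτ).2.2
        _ ≤ ‖M.B τ * M.w τ‖ * (|c| * ρ τ ^ m) * (|K| * L * ρ τ) := by gcongr
        _ = _ := by rw [abs_mul, hρ', Real.norm_eq_abs]; ring
  have hswap := integral_integral_swap hint
  have hl : ∫ τ in M.I, (M.B τ * M.w τ) •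
      (M.C τ ^ (κ - 1) • ∫ σ in M.I, (M.Abar τ σ * M.w σ) • F σ)
      = ∫ τ in M.I, ∫ σ in M.I, (M.B τ * M.w τ * M.C τ ^ (κ - 1)) •
        ((M.Abar τ σ * M.w σ) • F σ) := by
    refine integral_congr_ae (Eventually.of_forall fun τ => ?_)
    simp only
    rw [integral_smul, smul_smul]
  rw [hl, hswap]
  refine setIntegral_congr_fun M.measurableSet_I fun σ hσ => ?_
  -- `DN` does not contain `w σ`, so this factor stays with `F σ`.
  have h6 : ∀ τ, (M.B τ * M.w τ * M.C τ ^ (κ - 1)) • ((M.Abar τ σ * M.w σ) • F σ)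
      = (M.B τ * M.w τ * M.C τ ^ (κ - 1) * M.Abar τ σ) • (M.w σ • F σ) := fun τ => by
    simp only [smul_smul]; ring_nf
  simp_rw [h6]
  rw [integral_smul_const, (hDN κ hκ hκζ σ hσ).2, smul_smul, smul_smul]
  congr 1; ring

end Integrals

end CsRKN

/-! ### Taylor expansions along the exact solution. -/

section Taylor

variable {V : Type*} [NormedAddCommGroup V] [NormedSpace ℝ V]

/-- The `j`-th Taylor coefficient at `0` of a function of a real variable. -/
noncomputable def taylorCoeffZero (φ : ℝ → V) (j : ℕ) : V :=
  ((j.factorial : ℝ)⁻¹) • iteratedDeriv j φ 0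

/-- Peano's remainder for degree `N` is `o(s ^ N)`; dropping the term of degree `N` leaves `O(s ^
N)`. -/
theorem ContDiffAt.isBigO_sub_taylor {φ : ℝ → V} {N : ℕ} (hφ : ContDiffAt ℝ N φ 0) :
    (fun s => φ s - ∑ j ∈ Finset.range N, s ^ j • taylorCoeffZero φ j)
      =O[𝓝 0] fun s : ℝ => s ^ N := by
  obtain ⟨u, hu, hφu⟩ := hφ.contDiffOn (m := N) le_rfl (by simp)
  obtain ⟨δ, hδ, hδu⟩ := Metric.mem_nhds_iff.1 hu
  have h0 : (0 : ℝ) ∈ Metric.ball (0 : ℝ) δ := Metric.mem_ball_self hδ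
  have h1 := taylor_isLittleO (convex_ball (0 : ℝ) δ) h0 (hφu.mono hδu)
  rw [Metric.isOpen_ball.nhdsWithin_eq h0] at h1
  have h2 : ∀ s, φ s - ∑ j ∈ Finset.range N, s ^ j • taylorCoeffZero φ j
      = (φ s - taylorWithinEval φ N (Metric.ball 0 δ) 0 s) + s ^ N • taylorCoeffZero φ N := by
    intro s
    have h3 : taylorWithinEval φ N (Metric.ball 0 δ) 0 s
        = ∑ j ∈ Finset.range (N + 1), s ^ j • taylorCoeffZero φ j := by
      rw [taylor_within_apply]
      refine Finset.sum_congr rfl fun j _ => ?_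
      rw [taylorCoeffZero, iteratedDerivWithin_of_isOpen Metric.isOpen_ball h0, smul_smul,
        sub_zero, mul_comm]
    rw [h3, Finset.sum_range_succ]; abel
  simp_rw [h2]
  simp only [sub_zero] at h1
  refine h1.isBigO.add ?_
  refine IsBigO.of_bound ‖taylorCoeffZero φ N‖ (Eventually.of_forall fun s => ?_)
  rw [norm_smul, mul_comm]

/-- Termwise integration of Taylor series: it lets the expansions of `q'` and `q` be written with
the coefficients `γ` of `q''` alone. -/
theorem taylorCoeffZero_succ {φ ψ : ℝ → V} (h : ∀ᶠ s in 𝓝 0, HasDerivAt φ (ψ s) s) (j : ℕ) :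
    taylorCoeffZero φ (j + 1) = ((j : ℝ) + 1)⁻¹ • taylorCoeffZero ψ j := by
  have h1 : deriv φ =ᶠ[𝓝 0] ψ := h.mono fun s hs => hs.deriv
  rw [taylorCoeffZero, taylorCoeffZero, iteratedDeriv_succ', h1.iteratedDeriv_eq, smul_smul,
    Nat.factorial_succ]
  congr 1
  push_cast
  rw [mul_inv]

theorem taylorCoeffZero_zero (φ : ℝ → V) : taylorCoeffZero φ 0 = φ 0 := by
  simp [taylorCoeffZero]

/-- A function differentiable near `t₀` agrees near `t₀` with a continuous function which grows at
most linearly. -/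
theorem exists_continuous_eventuallyEq {q q' : ℝ → V} {t₀ : ℝ}
    (hq : ∀ᶠ t in 𝓝 t₀, HasDerivAt q (q' t) t) :
    ∃ x : ℝ → V, Continuous x ∧ (∃ L : ℝ, 0 ≤ L ∧ ∀ s, ‖x s - q t₀‖ ≤ L * |s|) ∧
      x =ᶠ[𝓝 0] fun s => q (t₀ + s) := by
  have ht : Tendsto (fun s : ℝ => t₀ + s) (𝓝 0) (𝓝 t₀) := by
    have : Continuous fun s : ℝ => t₀ + s := by fun_prop
    simpa using this.tendsto 0
  have h1 := hq.self_of_nhds.isBigO_sub.comp_tendsto ht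
  obtain ⟨L, hL⟩ := h1.bound
  obtain ⟨δ, hδ, hδL⟩ := Metric.eventually_nhds_iff.1 (hL.and (ht.eventually hq))
  -- Time is clamped to an interval on which `q` is differentiable and the linear bound holds;
  -- clamping does not increase `|s|`, so the bound becomes global.
  set c : ℝ → ℝ := fun s => max (-(δ / 2)) (min (δ / 2) s) with hc
  have hcc : Continuous c := by fun_prop
  have hcδ : ∀ s, dist (c s) 0 < δ := fun s => by
    have h2 : -(δ / 2) ≤ c s := le_max_left _ _
    have h3 : c s ≤ δ / 2 := max_le (by linarith) (min_le_left _ _)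
    rw [Real.dist_eq, sub_zero, abs_lt]; constructor <;> linarith
  have hcs : ∀ s, |c s| ≤ |s| := fun s => by
    simp only [hc]
    rcases le_total (δ / 2) s with h | h
    · rw [min_eq_left h, max_eq_right (by linarith), abs_of_pos (by linarith),
        abs_of_pos (by linarith)]; exact h
    · rw [min_eq_right h]
      rcases le_total (-(δ / 2)) s with h' | h'
      · rw [max_eq_right h']
      · rw [max_eq_left h', abs_neg, abs_of_pos (by linarith), abs_of_neg (by linarith)]; linarith
  refine ⟨fun s => q (t₀ + c s), ?_, ⟨|L|, abs_nonneg L, fun s => ?_⟩, ?_⟩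
  · refine continuous_iff_continuousAt.2 fun s => ?_
    have h2 := (hδL (hcδ s)).2.continuousAt
    exact ContinuousAt.comp (f := fun s => t₀ + c s) h2 (by fun_prop)
  · have h2 := (hδL (hcδ s)).1
    simp only [Function.comp_def, add_sub_cancel_left, Real.norm_eq_abs] at h2
    calc _ ≤ L * |c s| := h2
      _ ≤ |L| * |s| := mul_le_mul (le_abs_self L) (hcs s) (abs_nonneg _) (abs_nonneg _)
  · filter_upwards [Metric.ball_mem_nhds (0 : ℝ) (half_pos hδ)] with s hs
    rw [Metric.mem_ball, Real.dist_eq, sub_zero, abs_lt] at hs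
    simp only [hc]
    rw [min_eq_right hs.2.le, max_eq_right hs.1.le]

/-- Bootstrapping: the equation passes regularity of `(q, q')` on to its derivative. An open set
fixed in advance prevents the neighbourhood from shrinking with `n`. -/
theorem contDiffAt_solution {f : ℝ × V → V} (hf : ContDiff ℝ ∞ f) {q q' : ℝ → V} {t₀ : ℝ}
    (hq : ∀ᶠ t in 𝓝 t₀, HasDerivAt q (q' t) t ∧ HasDerivAt q' (f (t, q t)) t) (n : ℕ) :
    ContDiffAt ℝ n q t₀ ∧ ContDiffAt ℝ n q' t₀ := by
  obtain ⟨U, hU, hUo, htU⟩ := eventually_nhds_iff.1 hq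
  have key : ContDiffOn ℝ n q U ∧ ContDiffOn ℝ n q' U := by
    induction n with
    | zero =>
      simp only [CharP.cast_eq_zero, contDiffOn_zero]
      exact ⟨fun t ht => (hU t ht).1.continuousAt.continuousWithinAt,
        fun t ht => (hU t ht).2.continuousAt.continuousWithinAt⟩
    | succ n ih =>
      push_cast
      rw [contDiffOn_succ_iff_deriv_of_isOpen hUo, contDiffOn_succ_iff_deriv_of_isOpen hUo]
      refine ⟨⟨fun t ht => (hU t ht).1.differentiableAt.differentiableWithinAt, by simp, ?_⟩,
        ⟨fun t ht => (hU t ht).2.differentiableAt.differentiableWithinAt, by simp, ?_⟩⟩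
      · exact ih.2.congr fun t ht => (hU t ht).1.deriv
      · have h1 : ContDiffOn ℝ n (fun t => f (t, q t)) U :=
          (hf.of_le (by exact_mod_cast le_top)).comp_contDiffOn (contDiffOn_id.prodMk ih.1)
        exact h1.congr fun t ht => (hU t ht).2.deriv
  exact ⟨key.1.contDiffAt (hUo.mem_nhds htU), key.2.contDiffAt (hUo.mem_nhds htU)⟩

/-- The derivative of `f` with respect to the second variable. -/
noncomputable def fderivSnd (f : ℝ × V → V) (z : ℝ × V) : V →L[ℝ] V :=
  (fderiv ℝ f z).comp (ContinuousLinearMap.inr ℝ ℝ V)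

theorem ContDiff.fderivSnd {f : ℝ × V → V} (hf : ContDiff ℝ ∞ f) :
    ContDiff ℝ ∞ (fderivSnd f) :=
  (hf.fderiv_right (m := ∞) (by simp)).clm_comp contDiff_const

/-- Taylor expansions, at the initial time, of the solution of `q'' = f (t, q)`, of its velocity, and
of `f` and its derivative in the second variable along it. -/
theorem exists_taylor_solution {f : ℝ × V → V} (hf : ContDiff ℝ ∞ f) {q q' : ℝ → V} {t₀ : ℝ}
    (hq : ∀ᶠ t in 𝓝 t₀, HasDerivAt q (q' t) t ∧ HasDerivAt q' (f (t, q t)) t) :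
    ∃ (x : ℝ → V) (γ : ℕ → V) (J : ℕ → V →L[ℝ] V), Continuous x ∧
      (∃ L : ℝ, 0 ≤ L ∧ ∀ s, ‖x s - q t₀‖ ≤ L * |s|) ∧ (x =ᶠ[𝓝 0] fun s => q (t₀ + s)) ∧
      (∀ N : ℕ, (fun s => f (t₀ + s, x s) - ∑ j ∈ Finset.range N, s ^ j • γ j)
        =O[𝓝 0] fun s : ℝ => s ^ N) ∧
      (∀ N : ℕ, (fun s => q' (t₀ + s)
          - (q' t₀ + ∑ j ∈ Finset.range N, (s ^ (j + 1) / ((j : ℝ) + 1)) • γ j))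
        =O[𝓝 0] fun s : ℝ => s ^ (N + 1)) ∧
      (∀ N : ℕ, (fun s => x s - (q t₀ + s • q' t₀
          + ∑ j ∈ Finset.range N, (s ^ (j + 2) / (((j : ℝ) + 1) * ((j : ℝ) + 2))) • γ j))
        =O[𝓝 0] fun s : ℝ => s ^ (N + 2)) ∧
      (∀ N : ℕ, (fun s => fderivSnd f (t₀ + s, x s) - ∑ i ∈ Finset.range N, s ^ i • J i)
        =O[𝓝 0] fun s : ℝ => s ^ N) := by
  obtain ⟨x, hx, hL, hxq⟩ := exists_continuous_eventuallyEq (hq.mono fun t ht => ht.1)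
  have ht : Tendsto (fun s : ℝ => t₀ + s) (𝓝 0) (𝓝 t₀) := by
    have : Continuous fun s : ℝ => t₀ + s := by fun_prop
    simpa using this.tendsto 0
  have hshift : ∀ (n : ℕ) {φ : ℝ → V}, ContDiffAt ℝ n φ t₀ →
      ContDiffAt ℝ n (fun s => φ (t₀ + s)) 0 := fun n φ hφ =>
    ContDiffAt.comp (0 : ℝ) (by simpa using hφ) (contDiffAt_const.add contDiffAt_id)
  have hxs : ∀ n : ℕ, ContDiffAt ℝ n x 0 := fun n =>
    (hshift n (contDiffAt_solution hf hq n).1).congr_of_eventuallyEq hxq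
  have hx's : ∀ n : ℕ, ContDiffAt ℝ n (fun s => q' (t₀ + s)) 0 := fun n =>
    hshift n (contDiffAt_solution hf hq n).2
  have hpair : ∀ n : ℕ, ContDiffAt ℝ n (fun s => (t₀ + s, x s)) 0 := fun n =>
    (contDiffAt_const.add contDiffAt_id).prodMk (hxs n)
  have hle : ∀ n : ℕ, (n : WithTop ℕ∞) ≤ ∞ := fun n => by exact_mod_cast le_top
  have hd' : ∀ᶠ s in 𝓝 (0 : ℝ), HasDerivAt (fun s => q' (t₀ + s)) (f (t₀ + s, x s)) s := by
    filter_upwards [ht.eventually hq, hxq] with s hs hxs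
    rw [hxs]
    exact hs.2.comp_const_add t₀ s
  have hd : ∀ᶠ s in 𝓝 (0 : ℝ), HasDerivAt x (q' (t₀ + s)) s := by
    filter_upwards [ht.eventually hq, hxq.eventuallyEq_nhds] with s hs hxs
    exact (hs.1.comp_const_add t₀ s).congr_of_eventuallyEq hxs
  refine ⟨x, taylorCoeffZero fun s => f (t₀ + s, x s),
    taylorCoeffZero fun s => fderivSnd f (t₀ + s, x s), hx, hL, hxq, fun N => ?_, fun N => ?_,
    fun N => ?_, fun N => ?_⟩
  · exact ContDiffAt.isBigO_sub_taylor
      (ContDiffAt.comp (0 : ℝ) (hf.of_le (hle N)).contDiffAt (hpair N))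
  · have h := (hx's (N + 1)).isBigO_sub_taylor
    refine h.congr_left fun s => ?_
    rw [Finset.sum_range_succ', taylorCoeffZero_zero]
    simp only [taylorCoeffZero_succ hd', smul_smul, pow_zero, one_smul, add_zero, div_eq_mul_inv]
    abel
  · have h := (hxs (N + 2)).isBigO_sub_taylor
    refine h.congr_left fun s => ?_
    rw [Finset.sum_range_succ', Finset.sum_range_succ', taylorCoeffZero_zero]
    simp only [taylorCoeffZero_succ hd, taylorCoeffZero_succ hd']
    have h0 : x 0 = q t₀ := by simpa using hxq.self_of_nhds
    have hsum : ∀ j : ℕ, s ^ (j + 1 + 1) • ((((j + 1 : ℕ) : ℝ) + 1)⁻¹ • ((j : ℝ) + 1)⁻¹ •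
        taylorCoeffZero (fun s => f (t₀ + s, x s)) j) = (s ^ (j + 2) / (((j : ℝ) + 1) *
          ((j : ℝ) + 2))) • taylorCoeffZero (fun s => f (t₀ + s, x s)) j := fun j => by
      rw [smul_smul, smul_smul]
      congr 1
      push_cast
      rw [div_eq_mul_inv, mul_inv, add_assoc, one_add_one_eq_two]; ring
    simp only [hsum, taylorCoeffZero_zero, h0]
    simp
    abel
  · exact ContDiffAt.isBigO_sub_taylor
      (ContDiffAt.comp (0 : ℝ) (hf.fderivSnd.of_le (hle N)).contDiffAt (hpair N))

end Taylor

/-- A local `O(s ^ N)` bound, inserted at `s = C τ h`, gives a dominated one: where `C τ h` is not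
small, it is made up for by a power of `C τ`. -/
theorem CsRKN.IsDominated.domO_comp_of_isBigO {M : CsRKN} {d : ℕ}
    {f : ℝ × EuclideanSpace ℝ (Fin d) → EuclideanSpace ℝ (Fin d)}
    {t₀ : ℝ} {q₀ : EuclideanSpace ℝ (Fin d)} {r ρ : ℝ → ℝ}
    {V : Type*} [NormedAddCommGroup V] (hD : M.IsDominated f t₀ q₀ r ρ) {R : ℝ → V} {N : ℕ}
    (hR : R =O[𝓝 0] fun s : ℝ => s ^ N) (hR0 : M.DomO ρ 0 fun h τ => R (M.C τ * h)) :
    M.DomO ρ N fun h τ => R (M.C τ * h) := by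
  obtain ⟨c, hc⟩ := hR.bound
  obtain ⟨δ, hδ, hδc⟩ := Metric.eventually_nhds_iff.1 hc
  obtain ⟨hm, K, n, hK⟩ := hR0
  have hG : M.DomO ρ N fun h τ => (M.C τ * h) ^ N := by
    have := (hD.domO_C_pow N).mul (domO_pow N)
    rw [zero_add] at this
    exact this.congr (Eventually.of_forall fun h τ _ => (mul_pow _ _ _).symm)
  -- `|c|` serves where `|C τ h| < δ`; elsewhere `(|C τ h| / δ) ^ N ≥ 1` may be inserted into the
  -- order-zero bound.
  refine DomO.of_bound hD.one_le hG hm (K := |c| + |K| / δ ^ N) (n := n) ?_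
  filter_upwards [hK] with h hK τ hτ
  have hρ := one_le_pow₀ (n := n) (hD.one_le τ hτ)
  have hρ0 : 0 ≤ ρ τ ^ n := by linarith
  rw [norm_pow]
  rcases lt_or_ge ‖M.C τ * h‖ δ with hs | hs
  · have h1 := hδc (y := M.C τ * h) (by simpa [Real.dist_eq] using hs)
    rw [norm_pow] at h1
    calc ‖R (M.C τ * h)‖ ≤ c * ‖M.C τ * h‖ ^ N := h1
      _ ≤ |c| * 1 * ‖M.C τ * h‖ ^ N := by rw [mul_one]; gcongr; exact le_abs_self c
      _ ≤ (|c| + |K| / δ ^ N) * ρ τ ^ n * ‖M.C τ * h‖ ^ N := by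
        gcongr; exact le_add_of_nonneg_right (by positivity)
  · have h2 : 1 ≤ ‖M.C τ * h‖ ^ N / δ ^ N := by
      rw [one_le_div (by positivity)]; gcongr
    calc ‖R (M.C τ * h)‖ ≤ K * |h| ^ 0 * ρ τ ^ n := hK τ hτ
      _ = K * ρ τ ^ n * 1 := by ring
      _ ≤ |K| * ρ τ ^ n * (‖M.C τ * h‖ ^ N / δ ^ N) := by gcongr; exact le_abs_self K
      _ = (0 + |K| / δ ^ N) * ρ τ ^ n * ‖M.C τ * h‖ ^ N := by ring
      _ ≤ _ := by gcongr; exact abs_nonneg c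

/-! ### Bounds for `f` in the tube, and solvability of the stage equation. -/

namespace CsRKN

variable {M : CsRKN} {d : ℕ} {f : ℝ × EuclideanSpace ℝ (Fin d) → EuclideanSpace ℝ (Fin d)}
  {t₀ : ℝ} {q₀ : EuclideanSpace ℝ (Fin d)} {r ρ : ℝ → ℝ}

/-- On a bounded interval, the convergence condition holds for all smooth problems. -/
theorem IsAdmissibleRadius.exists_isDominated (h : M.IsAdmissibleRadius f t₀ q₀ r)
    (hcoeff : Bornology.IsBounded M.I → M.UniformlyIntegrableCoefficients)
    (hf : ContDiff ℝ ∞ f) : ∃ ρ, M.IsDominated f t₀ q₀ r ρ := by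
  rcases h with ⟨hI, R, hR, hr⟩ | h
  · have hM := hcoeff hI
    -- A constant `ρ` makes all weights `ρ ^ k` constants; the derivatives of `f` are bounded by
    -- compactness of closed balls in finite dimension.
    refine ⟨fun _ => max 1 R, ?_, ?_, fun _ _ => le_max_left _ _, ?_, ?_, ?_, ?_, ?_, ?_⟩
    · intro τ hτ; rw [hr τ hτ]; exact hR
    · intro τ hτ; rw [hr τ hτ]; exact le_max_right _ _
    · obtain ⟨K, hK⟩ := hM.bounded_C
      refine ⟨K / R, fun τ hτ => ?_⟩
      rw [hr τ hτ, div_mul_cancel₀ _ hR.ne']; exact hK τ hτ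
    · exact fun k τ hτ => (hM.integrable_Abar τ hτ).mul_const _
    · intro k
      obtain ⟨K, hK⟩ := hM.bounded_Abar
      refine ⟨K * max 1 R ^ k / R, fun τ hτ => ?_⟩
      have h0 : 0 ≤ max 1 R ^ k := by positivity
      simp_rw [abs_mul _ (max 1 R ^ k), abs_of_nonneg h0]
      rw [integral_mul_const, hr τ hτ, div_mul_cancel₀ _ hR.ne']
      exact mul_le_mul_of_nonneg_right (hK τ hτ) h0
    · exact fun k => hM.integrable_B.mul_const _
    · exact fun k => hM.integrable_Bbar.mul_const _
    · intro k
      have hc : IsCompact (Metric.closedBall t₀ R ×ˢ Metric.closedBall q₀ R) :=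
        (isCompact_closedBall _ _).prod (isCompact_closedBall _ _)
      obtain ⟨K, hK⟩ := hc.exists_bound_of_continuousOn
        (hf.continuous_iteratedFDeriv (m := k) (by exact_mod_cast le_top)).continuousOn
      refine ⟨K, 0, fun τ hτ t x ht hx => ?_⟩
      rw [hr τ hτ] at ht hx
      rw [pow_zero, mul_one]
      refine hK (t, x) ⟨?_, ?_⟩
      · rwa [Metric.mem_closedBall, Real.dist_eq]
      · rwa [Metric.mem_closedBall, dist_eq_norm]
  · exact h

theorem IsDominated.bound_apply (hD : M.IsDominated f t₀ q₀ r ρ) :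
    ∃ (K : ℝ) (n : ℕ), 0 ≤ K ∧ ∀ τ ∈ M.I, ∀ (t : ℝ) (x : EuclideanSpace ℝ (Fin d)),
      |t - t₀| ≤ r τ → ‖x - q₀‖ ≤ r τ → ‖f (t, x)‖ ≤ K * ρ τ ^ n := by
  obtain ⟨K, n, hK⟩ := hD.bound_f 0
  refine ⟨|K|, n, abs_nonneg K, fun τ hτ t x ht hx => ?_⟩
  have h1 := hK τ hτ t x ht hx
  rw [norm_iteratedFDeriv_zero] at h1
  have := hD.one_le τ hτ
  exact h1.trans (by gcongr; exact le_abs_self K)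

theorem IsDominated.bound_fderiv (hD : M.IsDominated f t₀ q₀ r ρ) :
    ∃ (K : ℝ) (n : ℕ), 0 ≤ K ∧ ∀ τ ∈ M.I, ∀ (t : ℝ) (x : EuclideanSpace ℝ (Fin d)),
      |t - t₀| ≤ r τ → ‖x - q₀‖ ≤ r τ → ‖fderivSnd f (t, x)‖ ≤ K * ρ τ ^ n := by
  obtain ⟨K, n, hK⟩ := hD.bound_f 1
  refine ⟨|K|, n, abs_nonneg K, fun τ hτ t x ht hx => ?_⟩
  have h1 := hK τ hτ t x ht hx
  rw [← norm_iteratedFDeriv_fderiv, norm_iteratedFDeriv_zero] at h1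
  have := hD.one_le τ hτ
  calc ‖fderivSnd f (t, x)‖ ≤ ‖fderiv ℝ f (t, x)‖ * ‖ContinuousLinearMap.inr ℝ ℝ _‖ :=
        ContinuousLinearMap.opNorm_comp_le _ _
    _ ≤ ‖fderiv ℝ f (t, x)‖ * 1 := by
        gcongr; exact ContinuousLinearMap.norm_inr_le_one ℝ ℝ _
    _ ≤ |K| * ρ τ ^ n := by rw [mul_one]; exact h1.trans (by gcongr; exact le_abs_self K)

theorem hasFDerivAt_snd (hf : ContDiff ℝ ∞ f) (t : ℝ) (x : EuclideanSpace ℝ (Fin d)) :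
    HasFDerivAt (fun y => f (t, y)) (fderivSnd f (t, x)) x :=
  HasFDerivAt.comp x (hf.differentiable (by simp) (t, x)).hasFDerivAt (hasFDerivAt_prodMk_right t x)

theorem IsDominated.lipschitz (hD : M.IsDominated f t₀ q₀ r ρ) (hf : ContDiff ℝ ∞ f) :
    ∃ (K : ℝ) (n : ℕ), 0 ≤ K ∧ ∀ τ ∈ M.I, ∀ (t : ℝ) (x y : EuclideanSpace ℝ (Fin d)),
      |t - t₀| ≤ r τ → ‖x - q₀‖ ≤ r τ → ‖y - q₀‖ ≤ r τ →
      ‖f (t, y) - f (t, x)‖ ≤ K * ρ τ ^ n * ‖y - x‖ := by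
  obtain ⟨K, n, hK0, hK⟩ := hD.bound_fderiv
  refine ⟨K, n, hK0, fun τ hτ t x y ht hx hy => ?_⟩
  have hb : ∀ z, z ∈ Metric.closedBall q₀ (r τ) ↔ ‖z - q₀‖ ≤ r τ := fun z => by
    rw [Metric.mem_closedBall, dist_eq_norm]
  exact (convex_closedBall q₀ (r τ)).norm_image_sub_le_of_norm_hasFDerivWithin_le
    (fun z _ => (hasFDerivAt_snd hf t z).hasFDerivWithinAt)
    (fun z hz => hK τ hτ t z ht ((hb z).1 hz)) ((hb x).2 hx) ((hb y).2 hy)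

theorem IsDominated.lipschitz_fderiv (hD : M.IsDominated f t₀ q₀ r ρ) (hf : ContDiff ℝ ∞ f) :
    ∃ (K : ℝ) (n : ℕ), 0 ≤ K ∧ ∀ τ ∈ M.I, ∀ (t : ℝ) (x y : EuclideanSpace ℝ (Fin d)),
      |t - t₀| ≤ r τ → ‖x - q₀‖ ≤ r τ → ‖y - q₀‖ ≤ r τ →
      ‖fderivSnd f (t, y) - fderivSnd f (t, x)‖ ≤ K * ρ τ ^ n * ‖y - x‖ := by
  obtain ⟨K, n, hK⟩ := hD.bound_f 2
  refine ⟨|K|, n, abs_nonneg K, fun τ hτ t x y ht hx hy => ?_⟩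
  have hb : ∀ z, z ∈ Metric.closedBall q₀ (r τ) ↔ ‖z - q₀‖ ≤ r τ := fun z => by
    rw [Metric.mem_closedBall, dist_eq_norm]
  have hρ := hD.one_le τ hτ
  have hf' : ContDiff ℝ ∞ (fderiv ℝ f) := hf.fderiv_right (m := ∞) (by simp)
  have hder : ∀ z, HasFDerivAt (fun y => fderiv ℝ f (t, y))
      ((fderiv ℝ (fderiv ℝ f) (t, z)).comp (ContinuousLinearMap.inr ℝ ℝ _)) z := fun z =>
    HasFDerivAt.comp z (hf'.differentiable (by simp) (t, z)).hasFDerivAt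
      (hasFDerivAt_prodMk_right t z)
  have h1 : ‖fderiv ℝ f (t, y) - fderiv ℝ f (t, x)‖ ≤ |K| * ρ τ ^ n * ‖y - x‖ := by
    refine (convex_closedBall q₀ (r τ)).norm_image_sub_le_of_norm_hasFDerivWithin_le
      (fun z _ => (hder z).hasFDerivWithinAt) (fun z hz => ?_) ((hb x).2 hx) ((hb y).2 hy)
    have h2 := hK τ hτ t z ht ((hb z).1 hz)
    rw [show 2 = 1 + 1 from rfl, ← norm_iteratedFDeriv_fderiv, ← zero_add 1,
      ← norm_iteratedFDeriv_fderiv, norm_iteratedFDeriv_zero] at h2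
    calc _ ≤ ‖fderiv ℝ (fderiv ℝ f) (t, z)‖ * ‖ContinuousLinearMap.inr ℝ ℝ _‖ :=
          ContinuousLinearMap.opNorm_comp_le _ _
      _ ≤ ‖fderiv ℝ (fderiv ℝ f) (t, z)‖ * 1 := by
          gcongr; exact ContinuousLinearMap.norm_inr_le_one ℝ ℝ _
      _ ≤ _ := by rw [mul_one]; exact h2.trans (by gcongr; exact le_abs_self K)
  calc ‖fderivSnd f (t, y) - fderivSnd f (t, x)‖
      = ‖(fderiv ℝ f (t, y) - fderiv ℝ f (t, x)).comp (ContinuousLinearMap.inr ℝ ℝ _)‖ := by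
        rw [fderivSnd, fderivSnd, ContinuousLinearMap.sub_comp]
    _ ≤ ‖fderiv ℝ f (t, y) - fderiv ℝ f (t, x)‖ * ‖ContinuousLinearMap.inr ℝ ℝ _‖ :=
        ContinuousLinearMap.opNorm_comp_le _ _
    _ ≤ ‖fderiv ℝ f (t, y) - fderiv ℝ f (t, x)‖ * 1 := by
        gcongr; exact ContinuousLinearMap.norm_inr_le_one ℝ ℝ _
    _ ≤ _ := by rw [mul_one]; exact h1

/-- Mean value inequality for `f (t, ·)` minus its linear part at `x`, on the segment from `x` to
`y`: there the derivative varies by at most `K ρ ^ n ‖y - x‖`. -/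
theorem IsDominated.bound_linearization (hD : M.IsDominated f t₀ q₀ r ρ) (hf : ContDiff ℝ ∞ f) :
    ∃ (K : ℝ) (n : ℕ), 0 ≤ K ∧ ∀ τ ∈ M.I, ∀ (t : ℝ) (x y : EuclideanSpace ℝ (Fin d)),
      |t - t₀| ≤ r τ → ‖x - q₀‖ ≤ r τ → ‖y - q₀‖ ≤ r τ →
      ‖f (t, y) - f (t, x) - fderivSnd f (t, x) (y - x)‖ ≤ K * ρ τ ^ n * ‖y - x‖ ^ 2 := by
  obtain ⟨K, n, hK0, hK⟩ := hD.lipschitz_fderiv hf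
  refine ⟨K, n, hK0, fun τ hτ t x y ht hx hy => ?_⟩
  have hρ := hD.one_le τ hτ
  have hsub : ∀ z ∈ segment ℝ x y, ‖z - q₀‖ ≤ r τ ∧ ‖z - x‖ ≤ ‖y - x‖ := fun z hz => by
    have h1 := (convex_closedBall q₀ (r τ)).segment_subset (x := x) (y := y)
      (by rwa [Metric.mem_closedBall, dist_eq_norm]) (by rwa [Metric.mem_closedBall, dist_eq_norm]) hz
    have h2 := (convex_closedBall x ‖y - x‖).segment_subset (x := x) (y := y)
      (by simp) (by rw [Metric.mem_closedBall, dist_eq_norm]) hz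
    rw [Metric.mem_closedBall, dist_eq_norm] at h1 h2
    exact ⟨h1, h2⟩
  have h3 := (convex_segment x y).norm_image_sub_le_of_norm_hasFDerivWithin_le
    (f := fun z => f (t, z) - fderivSnd f (t, x) z) (C := K * ρ τ ^ n * ‖y - x‖)
    (fun z _ => ((hasFDerivAt_snd hf t z).sub (fderivSnd f (t, x)).hasFDerivAt).hasFDerivWithinAt)
    (fun z hz => (hK τ hτ t x z ht hx (hsub z hz).1).trans
      (by gcongr; exact (hsub z hz).2)) (left_mem_segment ℝ x y) (right_mem_segment ℝ x y)
  calc ‖f (t, y) - f (t, x) - fderivSnd f (t, x) (y - x)‖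
      = ‖f (t, y) - fderivSnd f (t, x) y - (f (t, x) - fderivSnd f (t, x) x)‖ := by
        rw [map_sub]; congr 1; abel
    _ ≤ _ := h3
    _ = _ := by ring

/-- Since `C = O(r)`, one threshold for `h` keeps all abscissae, and the exact solution at them, in
the tube, even if `C` is unbounded. -/
theorem IsDominated.eventually_abs_C_mul_le (hD : M.IsDominated f t₀ q₀ r ρ) (L : ℝ) :
    ∀ᶠ h in 𝓝 (0 : ℝ), ∀ τ ∈ M.I, L * |M.C τ * h| ≤ r τ := by
  obtain ⟨K, hK⟩ := hD.bound_C
  have h1 : Tendsto (fun h : ℝ => |L| * |K| * |h|) (𝓝 0) (𝓝 0) := by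
    have : Continuous fun h : ℝ => |L| * |K| * |h| := by fun_prop
    simpa using this.tendsto 0
  filter_upwards [h1.eventually (gt_mem_nhds one_pos)] with h hh τ hτ
  have hr := hD.radius_pos τ hτ
  calc L * |M.C τ * h| ≤ |L| * |M.C τ * h| := by gcongr; exact le_abs_self L
    _ = |L| * (|M.C τ| * |h|) := by rw [abs_mul]
    _ ≤ |L| * (|K| * r τ * |h|) := by
      gcongr; exact (hK τ hτ).trans (by gcongr; exact le_abs_self K)
    _ = (|L| * |K| * |h|) * r τ := by ring
    _ ≤ 1 * r τ := by gcongr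
    _ = r τ := one_mul _

theorem aestronglyMeasurable_stage (hf : ContDiff ℝ ∞ f) (h : ℝ)
    {Q : ℝ → EuclideanSpace ℝ (Fin d)} (hQ : AEStronglyMeasurable Q (volume.restrict M.I)) :
    AEStronglyMeasurable (fun σ => f (t₀ + M.C σ * h, Q σ)) (volume.restrict M.I) :=
  hf.continuous.comp_aestronglyMeasurable
    (((M.measurable_C.mul_const h).const_add t₀).aestronglyMeasurable.prodMk hQ)

/-- For small `h`, the stage equation has exactly one solution in the tube of radius `r`. -/
theorem IsDominated.existsUnique_stage (hD : M.IsDominated f t₀ q₀ r ρ) (hf : ContDiff ℝ ∞ f)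
    (q'₀ : EuclideanSpace ℝ (Fin d)) :
    ∀ᶠ h in 𝓝 (0 : ℝ), ∃ Q : ℝ → EuclideanSpace ℝ (Fin d),
      M.IsStageSolution f t₀ q₀ q'₀ h Q ∧ (∀ τ ∈ M.I, ‖Q τ - q₀‖ ≤ r τ) ∧
      ∀ Q' : ℝ → EuclideanSpace ℝ (Fin d), M.IsStageSolution f t₀ q₀ q'₀ h Q' →
        (∀ τ ∈ M.I, ‖Q' τ - q₀‖ ≤ r τ) → Set.EqOn Q' Q M.I := by
  obtain ⟨K₀, n₀, hK₀, hf₀⟩ := hD.bound_apply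
  obtain ⟨K₁, n₁, hK₁, hf₁⟩ := hD.lipschitz hf
  obtain ⟨L₀, hL₀, hA₀⟩ := hD.integral_Abar_le (V := EuclideanSpace ℝ (Fin d)) n₀
  -- The extra power of `ρ` pays for `‖Q - Q'‖ ≤ θ r ≤ θ ρ`.
  obtain ⟨L₁, hL₁, hA₁⟩ := hD.integral_Abar_le (V := EuclideanSpace ℝ (Fin d)) (n₁ + 1)
  have hsmall₀ : ∀ᶠ h in 𝓝 (0 : ℝ), h ^ 2 * (K₀ * L₀) < 1 / 2 := by
    have h1 : Continuous fun h : ℝ => h ^ 2 * (K₀ * L₀) := by fun_prop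
    exact (h1.tendsto 0).eventually (gt_mem_nhds (by norm_num))
  have hsmall₁ : ∀ᶠ h in 𝓝 (0 : ℝ), h ^ 2 * (K₁ * L₁) < 1 / 2 := by
    have h1 : Continuous fun h : ℝ => h ^ 2 * (K₁ * L₁) := by fun_prop
    exact (h1.tendsto 0).eventually (gt_mem_nhds (by norm_num))
  filter_upwards [hsmall₀, hsmall₁, hD.eventually_abs_C_mul_le 1,
    hD.eventually_abs_C_mul_le (2 * ‖q'₀‖)] with h hs₀ hs₁ hC hCq
  have hC' : ∀ τ ∈ M.I, |t₀ + M.C τ * h - t₀| ≤ r τ := fun τ hτ => by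
    simpa using hC τ hτ
  set T : (ℝ → EuclideanSpace ℝ (Fin d)) → ℝ → EuclideanSpace ℝ (Fin d) := fun Q τ =>
    q₀ + (h * M.C τ) • q'₀ + h ^ 2 • ∫ σ in M.I, (M.Abar τ σ * M.w σ) • f (t₀ + M.C σ * h, Q σ)
    with hT
  have hTm : ∀ Q, AEStronglyMeasurable Q (volume.restrict M.I) →
      AEStronglyMeasurable (T Q) (volume.restrict M.I) := fun Q hQ =>
    ((aestronglyMeasurable_const.add
      ((M.measurable_C.const_mul h).aestronglyMeasurable.smul_const q'₀))).add
      ((aestronglyMeasurable_const (b := h ^ 2)).smul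
        (aestronglyMeasurable_integral_Abar (aestronglyMeasurable_stage hf h hQ) _))
  have hTr : ∀ Q, AEStronglyMeasurable Q (volume.restrict M.I) →
      (∀ τ ∈ M.I, ‖Q τ - q₀‖ ≤ r τ) → ∀ τ ∈ M.I, ‖T Q τ - q₀‖ ≤ r τ := fun Q hQ hQr τ hτ => by
    have hr := hD.radius_pos τ hτ
    have h1 := (hA₀ _ K₀ hK₀ (aestronglyMeasurable_stage (t₀ := t₀) hf h hQ)
      (fun σ hσ => hf₀ σ hσ _ _ (hC' σ hσ) (hQr σ hσ)) τ hτ).2.1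
    have h2 : T Q τ - q₀ = (h * M.C τ) • q'₀
        + h ^ 2 • ∫ σ in M.I, (M.Abar τ σ * M.w σ) • f (t₀ + M.C σ * h, Q σ) := by
      simp only [hT]; abel
    have h3 := hCq τ hτ
    rw [h2]
    calc _ ≤ |M.C τ * h| * ‖q'₀‖ + h ^ 2 * (K₀ * L₀ * r τ) := by
          refine (norm_add_le _ _).trans (add_le_add (le_of_eq ?_) ?_)
          · rw [norm_smul, Real.norm_eq_abs, mul_comm h]
          · rw [norm_smul, Real.norm_of_nonneg (sq_nonneg h)]
            gcongr
      _ = (2 * ‖q'₀‖ * |M.C τ * h|) / 2 + (h ^ 2 * (K₀ * L₀)) * r τ := by ring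
      _ ≤ r τ / 2 + 1 / 2 * r τ := by gcongr
      _ = r τ := by ring
  -- `T` halves distances in the weighted norm `sup ‖·‖ / r`. The Picard iterates then converge at
  -- every `τ ∈ I`, not just almost everywhere.
  have hTc : ∀ Q Q', AEStronglyMeasurable Q (volume.restrict M.I) →
      AEStronglyMeasurable Q' (volume.restrict M.I) → (∀ τ ∈ M.I, ‖Q τ - q₀‖ ≤ r τ) →
      (∀ τ ∈ M.I, ‖Q' τ - q₀‖ ≤ r τ) → ∀ θ : ℝ, 0 ≤ θ →
      (∀ τ ∈ M.I, ‖Q τ - Q' τ‖ ≤ θ * r τ) → ∀ τ ∈ M.I, ‖T Q τ - T Q' τ‖ ≤ θ / 2 * r τ := by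
    intro Q Q' hQ hQ' hQr hQr' θ hθ hQQ' τ hτ
    have hr := hD.radius_pos τ hτ
    have h1 := (hA₁ _ (K₁ * θ) (by positivity)
      ((aestronglyMeasurable_stage (t₀ := t₀) hf h hQ).sub (aestronglyMeasurable_stage hf h hQ'))
      (fun σ hσ => (hf₁ σ hσ _ _ _ (hC' σ hσ) (hQr' σ hσ) (hQr σ hσ)).trans (by
        have := hD.one_le σ hσ
        calc K₁ * ρ σ ^ n₁ * ‖Q σ - Q' σ‖ ≤ K₁ * ρ σ ^ n₁ * (θ * ρ σ) := by
              gcongr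
              exact (hQQ' σ hσ).trans (by gcongr; exact hD.radius_le σ hσ)
          _ = _ := by ring)) τ hτ).2.1
    have hi := (hA₀ _ K₀ hK₀ (aestronglyMeasurable_stage (t₀ := t₀) hf h hQ)
      (fun σ hσ => hf₀ σ hσ _ _ (hC' σ hσ) (hQr σ hσ)) τ hτ).1
    have hi' := (hA₀ _ K₀ hK₀ (aestronglyMeasurable_stage (t₀ := t₀) hf h hQ')
      (fun σ hσ => hf₀ σ hσ _ _ (hC' σ hσ) (hQr' σ hσ)) τ hτ).1
    have h2 : T Q τ - T Q' τ = h ^ 2 • ∫ σ in M.I, (M.Abar τ σ * M.w σ) •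
        ((fun σ => f (t₀ + M.C σ * h, Q σ)) - fun σ => f (t₀ + M.C σ * h, Q' σ)) σ := by
      simp only [hT, Pi.sub_apply, smul_sub]
      rw [integral_sub hi hi', smul_sub]; abel
    rw [h2, norm_smul, Real.norm_of_nonneg (sq_nonneg h)]
    calc _ ≤ h ^ 2 * (K₁ * θ * L₁ * r τ) := by gcongr
      _ = (h ^ 2 * (K₁ * L₁)) * (θ * r τ) := by ring
      _ ≤ 1 / 2 * (θ * r τ) := by gcongr
      _ = _ := by ring
  set S : ℕ → ℝ → EuclideanSpace ℝ (Fin d) := fun n => T^[n] fun _ => q₀ with hS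
  have hSs : ∀ n, S (n + 1) = T (S n) := fun n => Function.iterate_succ_apply' _ _ _
  have hSm : ∀ n, AEStronglyMeasurable (S n) (volume.restrict M.I) := fun n => by
    induction n with
    | zero => exact aestronglyMeasurable_const
    | succ n ih => rw [hSs]; exact hTm _ ih
  have hSr : ∀ n, ∀ τ ∈ M.I, ‖S n τ - q₀‖ ≤ r τ := fun n => by
    induction n with
    | zero => intro τ hτ; simpa [hS] using (hD.radius_pos τ hτ).le
    | succ n ih => rw [hSs]; exact hTr _ (hSm n) ih
  have hSd : ∀ n : ℕ, ∀ τ ∈ M.I, ‖S n τ - S (n + 1) τ‖ ≤ (1 / 2 : ℝ) ^ n * r τ := fun n => by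
    induction n with
    | zero => intro τ hτ; rw [norm_sub_rev, pow_zero, one_mul]; exact hSr 1 τ hτ
    | succ n ih =>
      intro τ hτ
      have := hTc _ _ (hSm n) (hSm (n + 1)) (hSr n) (hSr (n + 1)) _ (by positivity) ih τ hτ
      rw [← hSs, ← hSs] at this
      exact this.trans (le_of_eq (by ring))
  have hSd' : ∀ τ ∈ M.I, ∀ n, dist (S n τ) (S (n + 1) τ) ≤ r τ * (1 / 2 : ℝ) ^ n :=
    fun τ hτ n => by rw [dist_eq_norm, mul_comm]; exact hSd n τ hτ
  have hlim : ∀ τ ∈ M.I, ∃ l, Tendsto (fun n => S n τ) atTop (𝓝 l) := fun τ hτ =>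
    cauchySeq_tendsto_of_complete (cauchySeq_of_le_geometric (1 / 2) (r τ) (by norm_num) (hSd' τ hτ))
  choose! Q hQ using hlim
  have hQm : AEStronglyMeasurable Q (volume.restrict M.I) :=
    aestronglyMeasurable_of_tendsto_ae atTop hSm
      ((ae_restrict_iff' M.measurableSet_I).2 (Eventually.of_forall hQ))
  have hQr : ∀ τ ∈ M.I, ‖Q τ - q₀‖ ≤ r τ := fun τ hτ =>
    le_of_tendsto ((hQ τ hτ).sub_const q₀).norm (Eventually.of_forall fun n => hSr n τ hτ)
  have hQd : ∀ n : ℕ, ∀ τ ∈ M.I, ‖S n τ - Q τ‖ ≤ 2 * (1 / 2 : ℝ) ^ n * r τ := fun n τ hτ => by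
    have := dist_le_of_le_geometric_of_tendsto (1 / 2) (r τ) (by norm_num) (hSd' τ hτ) (hQ τ hτ) n
    rw [dist_eq_norm] at this
    exact this.trans (le_of_eq (by ring))
  have hpow : ∀ c : ℝ, Tendsto (fun n : ℕ => 2 * (1 / 2 : ℝ) ^ n * c) atTop (𝓝 0) := fun c => by
    have := ((tendsto_pow_atTop_nhds_zero_of_lt_one (r := (1 / 2 : ℝ)) (by norm_num)
      (by norm_num)).const_mul 2).mul_const c
    simpa using this
  have hQT : ∀ τ ∈ M.I, Q τ = T Q τ := fun τ hτ => by
    refine tendsto_nhds_unique ((tendsto_add_atTop_iff_nat 1).2 (hQ τ hτ)) ?_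
    rw [tendsto_iff_norm_sub_tendsto_zero]
    refine squeeze_zero (fun n => norm_nonneg _) (fun n => ?_) (hpow (r τ / 2))
    have := hTc _ _ (hSm n) hQm (hSr n) hQr _ (by positivity) (hQd n) τ hτ
    rw [← hSs] at this
    exact this.trans (le_of_eq (by ring))
  refine ⟨Q, ⟨hQm, fun τ hτ => ?_, ?_, ?_, hQT⟩, hQr, fun Q' hQ' hQr' τ hτ => ?_⟩
  · exact (hA₀ _ K₀ hK₀ (aestronglyMeasurable_stage hf h hQm)
      (fun σ hσ => hf₀ σ hσ _ _ (hC' σ hσ) (hQr σ hσ)) τ hτ).1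
  · exact (integrableOn_smul_of_le_pow (M.measurable_Bbar.mul M.measurable_w).aestronglyMeasurable
      (aestronglyMeasurable_stage hf h hQm) (hD.integrable_Bbar n₀) hD.one_le
      (fun σ hσ => hf₀ σ hσ _ _ (hC' σ hσ) (hQr σ hσ))).1
  · exact (integrableOn_smul_of_le_pow M.measurable_B_w.aestronglyMeasurable
      (aestronglyMeasurable_stage hf h hQm) (hD.integrable_B n₀) hD.one_le
      (fun σ hσ => hf₀ σ hσ _ _ (hC' σ hσ) (hQr σ hσ))).1
  -- Two solutions in the tube differ by at most `2 r`, and each application of `T` halves this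
  -- bound.
  · have hd : ∀ n : ℕ, ∀ τ ∈ M.I, ‖Q' τ - Q τ‖ ≤ 2 * (1 / 2 : ℝ) ^ n * r τ := fun n => by
      induction n with
      | zero =>
        intro τ hτ
        calc ‖Q' τ - Q τ‖ = ‖(Q' τ - q₀) - (Q τ - q₀)‖ := by congr 1; abel
          _ ≤ r τ + r τ := (norm_sub_le _ _).trans (add_le_add (hQr' τ hτ) (hQr τ hτ))
          _ = _ := by ring
      | succ n ih =>
        intro τ hτ
        have := hTc _ _ hQ'.aestronglyMeasurable hQm hQr' hQr _ (by positivity) ih τ hτ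
        rw [← hQT τ hτ, show T Q' τ = Q' τ from (hQ'.stage_eq τ hτ).symm] at this
        exact this.trans (le_of_eq (by ring))
    have := ge_of_tendsto (hpow (r τ)) (Eventually.of_forall fun n => hd n τ hτ)
    exact sub_eq_zero.1 (norm_le_zero_iff.1 this)

end CsRKN

/-! ### Consequences of the simplifying assumptions: stage errors and their moments. -/

namespace CsRKN

section OrderConditions

variable {M : CsRKN} {d : ℕ} {f : ℝ × EuclideanSpace ℝ (Fin d) → EuclideanSpace ℝ (Fin d)}
  {t₀ : ℝ} {q₀ : EuclideanSpace ℝ (Fin d)} {r ρ : ℝ → ℝ}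
  {V : Type*} [NormedAddCommGroup V] [NormedSpace ℝ V]

theorem IsDominated.domO_C_mul_pow (hD : M.IsDominated f t₀ q₀ r ρ) (k : ℕ) :
    M.DomO ρ k fun h τ => (M.C τ * h) ^ k := by
  have := (hD.domO_C_pow k).mul (domO_pow k)
  rw [zero_add] at this
  exact this.congr (Eventually.of_forall fun h τ _ => (mul_pow _ _ _).symm)

theorem isBigO_pow_of_le {m n : ℕ} (hmn : n ≤ m) :
    (fun h : ℝ => h ^ m) =O[𝓝 0] fun h : ℝ => h ^ n := by
  refine IsBigO.of_bound 1 ?_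
  filter_upwards [Metric.ball_mem_nhds (0 : ℝ) one_pos] with h hh
  rw [norm_pow, norm_pow, one_mul]
  exact pow_le_pow_of_le_one (norm_nonneg h) (by simpa using (Metric.mem_ball.1 hh).le) hmn

theorem AssumptionB.integral_pow {p : ℕ} (hB : M.AssumptionB p) {m : ℕ} (hm : m + 1 ≤ p) :
    Integrable (fun τ => M.B τ * M.w τ * M.C τ ^ m) (volume.restrict M.I) ∧
      ∫ τ in M.I, M.B τ * M.w τ * M.C τ ^ m = 1 / ((m : ℝ) + 1) := by
  simpa [IntegrableOn] using hB (m + 1) (by omega) hm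

/-- If `F` has a dominated expansion, then so has its integral against `B w`. -/
theorem IsDominated.isBigO_integral_B_sub_sum [CompleteSpace V] (hD : M.IsDominated f t₀ q₀ r ρ)
    {N k : ℕ} {F : ℝ → ℝ → V} {a ψ : ℕ → ℝ → ℝ} {c : ℕ → ℝ} {γ : ℕ → V}
    (hR : M.DomO ρ N fun h τ => F h τ - ∑ j ∈ Finset.range k, (a j h * ψ j τ) • γ j)
    (hψ : ∀ j < k, Integrable (fun τ => M.B τ * M.w τ * ψ j τ) (volume.restrict M.I) ∧
      ∫ τ in M.I, M.B τ * M.w τ * ψ j τ = c j) :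
    (fun h => (∫ τ in M.I, (M.B τ * M.w τ) • F h τ) - ∑ j ∈ Finset.range k, (a j h * c j) • γ j)
      =O[𝓝 0] fun h : ℝ => h ^ N := by
  refine (hD.isBigO_integral_B hR).congr' ?_ EventuallyEq.rfl
  filter_upwards [hD.integrable_B_smul hR] with h hi
  have hterm : ∀ j τ, (M.B τ * M.w τ) • ((a j h * ψ j τ) • γ j)
      = (M.B τ * M.w τ * ψ j τ) • (a j h • γ j) := fun j τ => by
    rw [smul_smul, smul_smul]; congr 1; ring
  have hs : Integrable (fun τ => ∑ j ∈ Finset.range k, (M.B τ * M.w τ * ψ j τ) • (a j h • γ j))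
      (volume.restrict M.I) :=
    integrable_finsetSum _ fun j hj => (hψ j (Finset.mem_range.1 hj)).1.smul_const _
  have hsum : ∫ τ in M.I, ∑ j ∈ Finset.range k, (M.B τ * M.w τ * ψ j τ) • (a j h • γ j)
      = ∑ j ∈ Finset.range k, (a j h * c j) • γ j := by
    rw [integral_finsetSum _ fun j hj => (hψ j (Finset.mem_range.1 hj)).1.smul_const _]
    refine Finset.sum_congr rfl fun j hj => ?_
    rw [integral_smul_const, (hψ j (Finset.mem_range.1 hj)).2, smul_smul, mul_comm]
  rw [eq_sub_iff_add_eq, ← hsum, ← integral_add hi hs]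
  refine integral_congr_ae (Eventually.of_forall fun τ => ?_)
  simp only [smul_sub, Finset.smul_sum, hterm, sub_add_cancel]

/-- The stages obtained from the exact solution satisfy the stage equation up to `O(h ^ (e + 2))`;
here `G` and `X` are the values of `f` and of `q - q₀ - s q'₀` along the exact solution. -/
theorem IsDominated.domO_defect [CompleteSpace V] (hD : M.IsDominated f t₀ q₀ r ρ) {e : ℕ}
    (hCN : M.AssumptionCN (e + 1)) {G X : ℝ → ℝ → V} {γ : ℕ → V}
    (hG : ∀ N, M.DomO ρ N fun h τ => G h τ - ∑ j ∈ Finset.range N, (M.C τ * h) ^ j • γ j)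
    (hX : ∀ N, M.DomO ρ (N + 2) fun h τ => X h τ - ∑ j ∈ Finset.range N,
      ((M.C τ * h) ^ (j + 2) / (((j : ℝ) + 1) * ((j : ℝ) + 2))) • γ j) :
    M.DomO ρ (e + 2) fun h τ => X h τ - h ^ 2 • ∫ σ in M.I, (M.Abar τ σ * M.w σ) • G h σ := by
  -- `CN` with `κ = j + 1` matches the terms `j < e` exactly, so only the two Taylor remainders
  -- survive.
  have h1 := (hD.domO_integral_Abar (hG e)).pow_smul 2
  rw [add_comm 2 e] at h1
  refine ((hX e).sub hD.one_le h1).congr ?_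
  filter_upwards [hD.integrable_Abar_smul (hG e)] with h hi τ hτ
  have hterm : ∀ j σ, (M.Abar τ σ * M.w σ) • ((M.C σ * h) ^ j • γ j)
      = (M.Abar τ σ * M.w σ * M.C σ ^ j) • (h ^ j • γ j) := fun j σ => by
    rw [smul_smul, smul_smul, mul_pow]; congr 1; ring
  have hmom : ∀ j ∈ Finset.range e,
      Integrable (fun σ => M.Abar τ σ * M.w σ * M.C σ ^ j) (volume.restrict M.I) ∧
      ∫ σ in M.I, M.Abar τ σ * M.w σ * M.C σ ^ j
        = M.C τ ^ (j + 2) / (((j : ℝ) + 1) * ((j : ℝ) + 2)) := fun j hj => by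
    have hj' := Finset.mem_range.1 hj
    have := hCN (j + 1) (by omega) (by omega) τ hτ
    simp only [Nat.add_sub_cancel, Nat.cast_add, Nat.cast_one, add_assoc, one_add_one_eq_two] at this
    exact this
  have hs : Integrable (fun σ => ∑ j ∈ Finset.range e, (M.Abar τ σ * M.w σ * M.C σ ^ j) •
      (h ^ j • γ j)) (volume.restrict M.I) :=
    integrable_finsetSum _ fun j hj => (hmom j hj).1.smul_const _
  have hsum : ∫ σ in M.I, (M.Abar τ σ * M.w σ) • G h σ
      = (∫ σ in M.I, (M.Abar τ σ * M.w σ) • (G h σ - ∑ j ∈ Finset.range e,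
          (M.C σ * h) ^ j • γ j))
        + ∑ j ∈ Finset.range e, (M.C τ ^ (j + 2) / (((j : ℝ) + 1) * ((j : ℝ) + 2))) •
          (h ^ j • γ j) := by
    have h2 : ∑ j ∈ Finset.range e, (M.C τ ^ (j + 2) / (((j : ℝ) + 1) * ((j : ℝ) + 2))) •
          (h ^ j • γ j) = ∫ σ in M.I, ∑ j ∈ Finset.range e, (M.Abar τ σ * M.w σ * M.C σ ^ j) •
            (h ^ j • γ j) := by
      rw [integral_finsetSum _ fun j hj => (hmom j hj).1.smul_const _]
      refine Finset.sum_congr rfl fun j hj => ?_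
      rw [integral_smul_const, (hmom j hj).2]
    rw [h2, ← integral_add (hi τ hτ) hs]
    refine integral_congr_ae (Eventually.of_forall fun σ => ?_)
    simp only [smul_sub, Finset.smul_sum, hterm, sub_add_cancel]
  have hfin : ∑ j ∈ Finset.range e, ((M.C τ * h) ^ (j + 2) / (((j : ℝ) + 1) * ((j : ℝ) + 2))) • γ j
      = h ^ 2 • ∑ j ∈ Finset.range e, (M.C τ ^ (j + 2) / (((j : ℝ) + 1) * ((j : ℝ) + 2))) •
          (h ^ j • γ j) := by
    rw [Finset.smul_sum]
    refine Finset.sum_congr rfl fun j _ => ?_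
    rw [smul_smul, smul_smul]; congr 1; ring
  rw [hsum, smul_add, hfin]
  abel

/-- The stage errors `E` are `O(h ^ (e + 2))`. -/
theorem IsDominated.domO_stage_error [CompleteSpace V] (hD : M.IsDominated f t₀ q₀ r ρ) {e : ℕ}
    (hCN : M.AssumptionCN (e + 1)) {G X E Y : ℝ → ℝ → V} {γ : ℕ → V}
    (hG : ∀ N, M.DomO ρ N fun h τ => G h τ - ∑ j ∈ Finset.range N, (M.C τ * h) ^ j • γ j)
    (hX : ∀ N, M.DomO ρ (N + 2) fun h τ => X h τ - ∑ j ∈ Finset.range N,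
      ((M.C τ * h) ^ (j + 2) / (((j : ℝ) + 1) * ((j : ℝ) + 2))) • γ j)
    (hE : M.DomO ρ 0 E) (hYE : ∀ k, M.DomO ρ k E → M.DomO ρ k Y)
    (hrel : ∀ᶠ h in 𝓝 (0 : ℝ), ∀ τ ∈ M.I,
      E h τ = h ^ 2 • (∫ σ in M.I, (M.Abar τ σ * M.w σ) • (Y h σ + G h σ)) - X h τ) :
    M.DomO ρ (e + 2) E := by
  have hG0 : M.DomO ρ 0 G := by simpa using hG 0
  have key : ∀ k ≤ e + 2, M.DomO ρ k E := fun k => by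
    induction k with
    | zero => exact fun _ => hE
    | succ k ih =>
      intro hk
      have hY := hYE k (ih (by omega))
      -- The factor `h²` gains two orders per pass; one is enough for the induction.
      have h1 := ((hD.domO_integral_Abar hY).pow_smul 2).mono hD.one_le (N' := k + 1) (by omega)
      have h2 := (hD.domO_defect hCN hG hX).mono hD.one_le hk
      refine (h1.sub hD.one_le h2).congr ?_
      filter_upwards [hrel, hD.integrable_Abar_smul hY, hD.integrable_Abar_smul hG0]
        with h hrel hiY hiG τ hτ
      rw [hrel τ hτ]
      simp only [smul_add]
      rw [integral_add (hiY τ hτ) (hiG τ hτ), smul_add]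
      abel
  exact key _ le_rfl

/-- Bounds for the moments of `E` give bounds for the moments of `Y = ∑ (C h) ^ i J i E + O(h ^ s)`. -/
theorem IsDominated.isBigO_moment_of_expansion [CompleteSpace V]
    (hD : M.IsDominated f t₀ q₀ r ρ) {s z b m : ℕ} {E Y : ℝ → ℝ → V} {J : ℕ → V →L[ℝ] V}
    (hE : M.DomO ρ 0 E)
    (hY : M.DomO ρ s fun h τ => Y h τ - ∑ i ∈ Finset.range z, (M.C τ * h) ^ i • J i (E h τ))
    (hb : 1 ≤ b)
    (hmom : ∀ i, (fun h : ℝ => h ^ (b + i) • ∫ τ in M.I, (M.B τ * M.w τ) •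
      (M.C τ ^ (m + i) • E h τ)) =O[𝓝 0] fun h : ℝ => h ^ (s + 1)) :
    (fun h : ℝ => h ^ b • ∫ τ in M.I, (M.B τ * M.w τ) • (M.C τ ^ m • Y h τ))
      =O[𝓝 0] fun h : ℝ => h ^ (s + 1) := by
  -- Here `1 ≤ b` lifts the remainder from order `s` to `s + 1`.
  have hR := ((domO_pow (M := M) (ρ := ρ) b).smul ((hD.domO_C_pow m).smul hY)).mono hD.one_le
    (N' := s + 1) (by omega)
  have hCE : ∀ i, M.DomO ρ 0 fun h τ => M.C τ ^ (m + i) • E h τ := fun i =>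
    (hD.domO_C_pow (m + i)).smul hE
  have h1 := (hD.isBigO_integral_B hR).add (IsBigO.sum (s := Finset.range z) fun i _ =>
    ((J i).isBigO_comp (fun h : ℝ => h ^ (b + i) • ∫ τ in M.I, (M.B τ * M.w τ) •
      (M.C τ ^ (m + i) • E h τ)) (𝓝 0)).trans (hmom i))
  refine h1.congr' ?_ EventuallyEq.rfl
  filter_upwards [hD.integrable_B_smul hR, (Finset.eventually_all (Finset.range z)).2
    fun i _ => hD.integrable_B_smul (hCE i)] with h hi hiE
  have hterm : ∀ i ∈ Finset.range z, J i (h ^ (b + i) • ∫ τ in M.I, (M.B τ * M.w τ) •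
      (M.C τ ^ (m + i) • E h τ)) = ∫ τ in M.I, h ^ (b + i) • J i ((M.B τ * M.w τ) •
        (M.C τ ^ (m + i) • E h τ)) := fun i hi => by
    rw [map_smul, ← ContinuousLinearMap.integral_comp_comm _ (hiE i hi), integral_smul]
  have hint : ∀ i ∈ Finset.range z, Integrable (fun τ => h ^ (b + i) • J i ((M.B τ * M.w τ) •
      (M.C τ ^ (m + i) • E h τ))) (volume.restrict M.I) := fun i hi =>
    ((J i).integrable_comp (hiE i hi)).smul (h ^ (b + i))
  rw [Finset.sum_apply, Finset.sum_congr rfl hterm, ← integral_finsetSum _ hint,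
    ← integral_add hi (integrable_finsetSum _ hint), ← integral_smul]
  refine integral_congr_ae (Eventually.of_forall fun τ => ?_)
  simp only [smul_sub, Finset.smul_sum, map_smul, smul_smul]
  rw [sub_add_eq_add_sub, sub_eq_iff_eq_add]
  congr 1
  · congr 1; ring
  · refine Finset.sum_congr rfl fun i _ => ?_
    congr 1; ring

/-- The quadrature formula `(C, B w)` of order `p`, applied to the difference of the two sides of
`∫ φ(c) h² q''(t₀ + c h) dc = ∫ c ^ l (q(t₀ + c h) - q₀ - c h q'₀) dc` on `[0, 1]`, where `φ` is the
polynomial of the assumption `DN`. -/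
theorem IsDominated.isBigO_quadrature [CompleteSpace V] (hD : M.IsDominated f t₀ q₀ r ρ) {p : ℕ}
    (hB : M.AssumptionB p) {G X : ℝ → ℝ → V} {γ : ℕ → V}
    (hG : ∀ N, M.DomO ρ N fun h τ => G h τ - ∑ j ∈ Finset.range N, (M.C τ * h) ^ j • γ j)
    (hX : ∀ N, M.DomO ρ (N + 2) fun h τ => X h τ - ∑ j ∈ Finset.range N,
      ((M.C τ * h) ^ (j + 2) / (((j : ℝ) + 1) * ((j : ℝ) + 2))) • γ j) (l : ℕ) :
    (fun h : ℝ => ∫ τ in M.I, (M.B τ * M.w τ) •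
      (h ^ 2 • (M.C τ ^ (l + 2) / (((l : ℝ) + 1) * ((l : ℝ) + 2)) - M.C τ / ((l : ℝ) + 1)
        + 1 / ((l : ℝ) + 2)) • G h τ - M.C τ ^ l • X h τ))
      =O[𝓝 0] fun h : ℝ => h ^ (p - (l + 2) + 2) := by
  -- The highest power of `C` met is `l + j + 2`; `B(p)` integrates it exactly for `j < N`.
  set N := p - (l + 2) with hN
  have hφ : M.DomO ρ 0 fun _ τ => M.C τ ^ (l + 2) / (((l : ℝ) + 1) * ((l : ℝ) + 2))
      - M.C τ / ((l : ℝ) + 1) + 1 / ((l : ℝ) + 2) := by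
    have h1 := ((hD.domO_C_pow (l + 2)).mul (domO_vec (1 / (((l : ℝ) + 1) * ((l : ℝ) + 2)))))
    have h2 := hD.domO_C.mul (domO_vec (1 / ((l : ℝ) + 1)))
    refine ((h1.sub hD.one_le h2).add hD.one_le (domO_vec (1 / ((l : ℝ) + 2)))).congr
      (Eventually.of_forall fun h τ _ => ?_)
    ring
  have hR : M.DomO ρ (N + 2) fun h τ =>
      h ^ 2 • (M.C τ ^ (l + 2) / (((l : ℝ) + 1) * ((l : ℝ) + 2)) - M.C τ / ((l : ℝ) + 1)
        + 1 / ((l : ℝ) + 2)) • (G h τ - ∑ j ∈ Finset.range N, (M.C τ * h) ^ j • γ j)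
      - M.C τ ^ l • (X h τ - ∑ j ∈ Finset.range N,
        ((M.C τ * h) ^ (j + 2) / (((j : ℝ) + 1) * ((j : ℝ) + 2))) • γ j) :=
    (((hφ.smul (hG N)).pow_smul 2).mono hD.one_le (by omega)).sub hD.one_le
      (((hD.domO_C_pow l).smul (hX N)).mono hD.one_le (by omega))
  have hmain := hD.isBigO_integral_B_sub_sum (k := N) (N := N + 2) (γ := γ)
    (F := fun h τ => h ^ 2 • (M.C τ ^ (l + 2) / (((l : ℝ) + 1) * ((l : ℝ) + 2))
      - M.C τ / ((l : ℝ) + 1) + 1 / ((l : ℝ) + 2)) • G h τ - M.C τ ^ l • X h τ)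
    (a := fun j h => h ^ (j + 2))
    (ψ := fun j τ => (1 / (((l : ℝ) + 1) * ((l : ℝ) + 2)) - 1 / (((j : ℝ) + 1) * ((j : ℝ) + 2)))
      * M.C τ ^ (l + j + 2) - 1 / ((l : ℝ) + 1) * M.C τ ^ (j + 1) + 1 / ((l : ℝ) + 2) * M.C τ ^ j)
    -- The `j`-th terms cancel on `[0, 1]`: integrate by parts twice, with `φ'' = c ^ l`, `φ(1) =
    -- φ'(1) = 0`, and `c ^ (j + 2)` vanishing doubly at `0`.
    (c := fun _ => 0) ?_ ?_
  · simpa using hmain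
  · refine hR.congr (Eventually.of_forall fun h τ _ => ?_)
    simp only [smul_sub, Finset.smul_sum, smul_smul]
    rw [sub_sub_sub_comm, ← Finset.sum_sub_distrib]
    congr 1
    refine Finset.sum_congr rfl fun j _ => ?_
    rw [← sub_smul]; congr 1; ring
  · intro j hj
    obtain ⟨i1, v1⟩ := hB.integral_pow (m := l + j + 2) (by omega)
    obtain ⟨i2, v2⟩ := hB.integral_pow (m := j + 1) (by omega)
    obtain ⟨i3, v3⟩ := hB.integral_pow (m := j) (by omega)
    have h1 := i1.const_mul (1 / (((l : ℝ) + 1) * ((l : ℝ) + 2))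
      - 1 / (((j : ℝ) + 1) * ((j : ℝ) + 2)))
    have h2 := i2.const_mul (1 / ((l : ℝ) + 1))
    have h3 := i3.const_mul (1 / ((l : ℝ) + 2))
    have heq : (fun τ => M.B τ * M.w τ * ((1 / (((l : ℝ) + 1) * ((l : ℝ) + 2))
        - 1 / (((j : ℝ) + 1) * ((j : ℝ) + 2))) * M.C τ ^ (l + j + 2)
        - 1 / ((l : ℝ) + 1) * M.C τ ^ (j + 1) + 1 / ((l : ℝ) + 2) * M.C τ ^ j))
        = fun τ => (1 / (((l : ℝ) + 1) * ((l : ℝ) + 2)) - 1 / (((j : ℝ) + 1) * ((j : ℝ) + 2)))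
          * (M.B τ * M.w τ * M.C τ ^ (l + j + 2)) - 1 / ((l : ℝ) + 1) * (M.B τ * M.w τ *
          M.C τ ^ (j + 1)) + 1 / ((l : ℝ) + 2) * (M.B τ * M.w τ * M.C τ ^ j) := by
      funext τ; ring
    rw [heq]
    refine ⟨(h1.sub h2).add h3, ?_⟩
    have e1 := integral_add (h1.sub h2) h3
    simp only [Pi.sub_apply] at e1
    rw [e1, integral_sub h1 h2]
    simp only [integral_const_mul]
    rw [v1, v2, v3]
    push_cast
    field_simp
    ring

/-- The moments of the stage errors: `h ^ a ∫ B w C ^ l E = O(h ^ (s + 1))` for `l < a`. -/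
theorem IsDominated.isBigO_moment [CompleteSpace V] (hD : M.IsDominated f t₀ q₀ r ρ)
    {p e z s : ℕ} (hB : M.AssumptionB p) (hDN : M.AssumptionDN (z + 1))
    (hsp : s ≤ p) (hsz : s ≤ e + z + 2) {G X E Y : ℝ → ℝ → V} {γ : ℕ → V} {J : ℕ → V →L[ℝ] V}
    (hG : ∀ N, M.DomO ρ N fun h τ => G h τ - ∑ j ∈ Finset.range N, (M.C τ * h) ^ j • γ j)
    (hX : ∀ N, M.DomO ρ (N + 2) fun h τ => X h τ - ∑ j ∈ Finset.range N,
      ((M.C τ * h) ^ (j + 2) / (((j : ℝ) + 1) * ((j : ℝ) + 2))) • γ j)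
    (hE : M.DomO ρ (e + 2) E) (hY0 : M.DomO ρ 0 Y)
    (hY : M.DomO ρ s fun h τ => Y h τ - ∑ i ∈ Finset.range z, (M.C τ * h) ^ i • J i (E h τ))
    (hrel : ∀ᶠ h in 𝓝 (0 : ℝ), ∀ τ ∈ M.I,
      E h τ = h ^ 2 • (∫ σ in M.I, (M.Abar τ σ * M.w σ) • (Y h σ + G h σ)) - X h τ)
    {a l : ℕ} (hla : l < a) :
    (fun h : ℝ => h ^ a • ∫ τ in M.I, (M.B τ * M.w τ) • (M.C τ ^ l • E h τ))
      =O[𝓝 0] fun h : ℝ => h ^ (s + 1) := by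
  -- Descending induction on `a`, with `n` bounding its distance to `z + 1`. For `n = 0` one has `a
  -- + (e + 2) ≥ e + z + 3 ≥ s + 1`.
  obtain ⟨n, hn⟩ : ∃ n, z + 1 ≤ a + n := ⟨z + 1, by omega⟩
  induction n generalizing a l with
  | zero =>
    have h1 := ((domO_pow (M := M) (ρ := ρ) a).smul ((hD.domO_C_pow l).smul hE)).mono hD.one_le
      (N' := s + 1) (by omega)
    refine (hD.isBigO_integral_B h1).congr_left fun h => ?_
    rw [← integral_smul]
    refine integral_congr_ae (Eventually.of_forall fun τ => ?_)
    simp only [smul_smul]; congr 1; ring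
  | succ n ih =>
    rcases Nat.lt_or_ge z a with hza | hza
    · exact ih hla (by omega)
    have hG0 : M.DomO ρ 0 G := by simpa using hG 0
    have hX0 : M.DomO ρ 0 X := DomO.mono hD.one_le (Nat.zero_le 2) (by simpa using hX 0)
    have hE0 := hE.mono hD.one_le (Nat.zero_le _)
    have hmom : ∀ m b : ℕ, m < b → a + 2 ≤ b →
        (fun h : ℝ => h ^ b • ∫ τ in M.I, (M.B τ * M.w τ) • (M.C τ ^ m • Y h τ))
          =O[𝓝 0] fun h : ℝ => h ^ (s + 1) := fun m b hmb hab =>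
      hD.isBigO_moment_of_expansion hE0 hY (by omega) fun i => ih (by omega) (by omega)
    have hquad : (fun h : ℝ => h ^ a • ∫ τ in M.I, (M.B τ * M.w τ) •
        (h ^ 2 • (M.C τ ^ (l + 2) / (((l : ℝ) + 1) * ((l : ℝ) + 2)) - M.C τ / ((l : ℝ) + 1)
          + 1 / ((l : ℝ) + 2)) • G h τ - M.C τ ^ l • X h τ))
        =O[𝓝 0] fun h : ℝ => h ^ (s + 1) := by
      refine ((isBigO_refl (fun h : ℝ => h ^ a) _).smul
        (hD.isBigO_quadrature hB hG hX l)).trans ?_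
      simp only [smul_eq_mul, ← pow_add]
      exact isBigO_pow_of_le (by omega)
    have hsum := (((hmom (l + 2) (a + 2) (by omega) le_rfl).const_smul_left
      (1 / (((l : ℝ) + 1) * ((l : ℝ) + 2)))).sub ((hmom 1 (a + 2) (by omega) le_rfl).const_smul_left
      (1 / ((l : ℝ) + 1)))).add ((hmom 0 (a + 2) (by omega) le_rfl).const_smul_left
      (1 / ((l : ℝ) + 2)))
    refine (hsum.add hquad).congr' ?_ EventuallyEq.rfl
    have hYG := hY0.add hD.one_le hG0
    obtain ⟨hYGm, K, n', hK⟩ := id hYG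
    have hφY : ∀ m, M.DomO ρ 0 fun h τ => M.C τ ^ m • Y h τ := fun m => (hD.domO_C_pow m).smul hY0
    have hφG : ∀ m, M.DomO ρ 0 fun h τ => M.C τ ^ m • G h τ := fun m => (hD.domO_C_pow m).smul hG0
    filter_upwards [hrel, hYGm, hK, hD.integrable_B_smul (hφY (l + 2)),
      hD.integrable_B_smul (hφY 1), hD.integrable_B_smul (hφY 0),
      hD.integrable_B_smul (hφG (l + 2)), hD.integrable_B_smul (hφG 1),
      hD.integrable_B_smul (hφG 0), hD.integrable_B_smul ((hD.domO_C_pow l).smul hX0),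
      hD.integrable_B_smul ((hD.domO_C_pow l).smul (hD.domO_integral_Abar hYG))]
      with h hrel hYGm hK iY2 iY1 iY0 iG2 iG1 iG0 iX iA
    -- `l < a ≤ z` gives `κ + 1 ≤ z + 1`, the range of `DN`.
    have hswap := hD.integral_B_integral_Abar hDN (κ := l + 1) (by omega) (by omega) hYGm hK
    have hφF : ∀ F : ℝ → V,
        Integrable (fun τ => (M.B τ * M.w τ) • (M.C τ ^ (l + 2) • F τ)) (volume.restrict M.I) →
        Integrable (fun τ => (M.B τ * M.w τ) • (M.C τ ^ 1 • F τ)) (volume.restrict M.I) →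
        Integrable (fun τ => (M.B τ * M.w τ) • (M.C τ ^ 0 • F τ)) (volume.restrict M.I) →
        Integrable (fun τ => (M.B τ * M.w τ) • ((M.C τ ^ (l + 2) / (((l : ℝ) + 1) * ((l : ℝ) + 2))
          - M.C τ / ((l : ℝ) + 1) + 1 / ((l : ℝ) + 2)) • F τ)) (volume.restrict M.I) ∧
        ∫ τ in M.I, (M.B τ * M.w τ) • ((M.C τ ^ (l + 2) / (((l : ℝ) + 1) * ((l : ℝ) + 2))
          - M.C τ / ((l : ℝ) + 1) + 1 / ((l : ℝ) + 2)) • F τ)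
        = (1 / (((l : ℝ) + 1) * ((l : ℝ) + 2))) •
            (∫ τ in M.I, (M.B τ * M.w τ) • (M.C τ ^ (l + 2) • F τ))
          - (1 / ((l : ℝ) + 1)) • (∫ τ in M.I, (M.B τ * M.w τ) • (M.C τ ^ 1 • F τ))
          + (1 / ((l : ℝ) + 2)) • (∫ τ in M.I, (M.B τ * M.w τ) • (M.C τ ^ 0 • F τ)) := by
      intro F i2 i1 i0
      have j2 := i2.smul (1 / (((l : ℝ) + 1) * ((l : ℝ) + 2)))
      have j1 := i1.smul (1 / ((l : ℝ) + 1))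
      have j0 := i0.smul (1 / ((l : ℝ) + 2))
      have heq : (fun τ => (M.B τ * M.w τ) • ((M.C τ ^ (l + 2) / (((l : ℝ) + 1) * ((l : ℝ) + 2))
          - M.C τ / ((l : ℝ) + 1) + 1 / ((l : ℝ) + 2)) • F τ))
          = (1 / (((l : ℝ) + 1) * ((l : ℝ) + 2))) •
              (fun τ => (M.B τ * M.w τ) • (M.C τ ^ (l + 2) • F τ))
            - (1 / ((l : ℝ) + 1)) • (fun τ => (M.B τ * M.w τ) • (M.C τ ^ 1 • F τ))
            + (1 / ((l : ℝ) + 2)) • (fun τ => (M.B τ * M.w τ) • (M.C τ ^ 0 • F τ)) := by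
        funext τ
        simp only [Pi.add_apply, Pi.sub_apply, Pi.smul_apply]
        module
      rw [heq]
      refine ⟨(j2.sub j1).add j0, ?_⟩
      rw [integral_add' (j2.sub j1) j0, integral_sub' j2 j1]
      simp only [Pi.smul_apply, integral_smul]
    obtain ⟨jY, vY⟩ := hφF (Y h) iY2 iY1 iY0
    obtain ⟨jG, vG⟩ := hφF (G h) iG2 iG1 iG0
    have hEint : ∫ τ in M.I, (M.B τ * M.w τ) • (M.C τ ^ l • E h τ)
        = h ^ 2 • (∫ τ in M.I, (M.B τ * M.w τ) • (M.C τ ^ l •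
            ∫ σ in M.I, (M.Abar τ σ * M.w σ) • (Y h σ + G h σ)))
          - ∫ τ in M.I, (M.B τ * M.w τ) • (M.C τ ^ l • X h τ) := by
      have hs := integral_sub (iA.smul (h ^ 2)) iX
      simp only [Pi.smul_apply] at hs
      rw [← integral_smul, ← hs]
      refine setIntegral_congr_fun M.measurableSet_I fun τ hτ => ?_
      simp only [hrel τ hτ]
      module
    have hGX : ∫ τ in M.I, (M.B τ * M.w τ) •
        (h ^ 2 • (M.C τ ^ (l + 2) / (((l : ℝ) + 1) * ((l : ℝ) + 2)) - M.C τ / ((l : ℝ) + 1)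
          + 1 / ((l : ℝ) + 2)) • G h τ - M.C τ ^ l • X h τ)
        = h ^ 2 • (∫ τ in M.I, (M.B τ * M.w τ) • ((M.C τ ^ (l + 2) / (((l : ℝ) + 1) *
            ((l : ℝ) + 2)) - M.C τ / ((l : ℝ) + 1) + 1 / ((l : ℝ) + 2)) • G h τ))
          - ∫ τ in M.I, (M.B τ * M.w τ) • (M.C τ ^ l • X h τ) := by
      have hs := integral_sub (jG.smul (h ^ 2)) iX
      simp only [Pi.smul_apply] at hs
      rw [← integral_smul, ← hs]
      refine integral_congr_ae (Eventually.of_forall fun τ => ?_)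
      simp only
      module
    simp only [Nat.add_sub_cancel, Nat.cast_add, Nat.cast_one, add_assoc,
      one_add_one_eq_two] at hswap
    simp only [add_assoc] at jY jG vY vG hGX ⊢
    simp only [smul_add] at hswap hEint
    rw [integral_add (by simpa only [smul_add] using jY) (by simpa only [smul_add] using jG)] at hswap
    rw [hEint, hGX, hswap, vY, vG]
    simp only [Pi.smul_apply]
    module

end OrderConditions

end CsRKN

/-! ### Local errors of the updates, and the theorem. -/

namespace CsRKN

section LocalErrors

variable {M : CsRKN} {d : ℕ} {f : ℝ × EuclideanSpace ℝ (Fin d) → EuclideanSpace ℝ (Fin d)}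
  {t₀ : ℝ} {q₀ : EuclideanSpace ℝ (Fin d)} {r ρ : ℝ → ℝ}

section Update

variable {V : Type*} [NormedAddCommGroup V] [NormedSpace ℝ V] [CompleteSpace V]

theorem IsDominated.isBigO_velocity_error (hD : M.IsDominated f t₀ q₀ r ρ)
    {p s : ℕ} (hB : M.AssumptionB p) (hsp : s ≤ p) {G Y : ℝ → ℝ → V} {γ : ℕ → V}
    {v : ℝ → V} {v₀ : V}
    (hG : ∀ N, M.DomO ρ N fun h τ => G h τ - ∑ j ∈ Finset.range N, (M.C τ * h) ^ j • γ j)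
    (hY0 : M.DomO ρ 0 Y)
    (hv : ∀ N : ℕ, (fun h => v h - (v₀ + ∑ j ∈ Finset.range N, (h ^ (j + 1) / ((j : ℝ) + 1)) • γ j))
      =O[𝓝 0] fun h : ℝ => h ^ (N + 1))
    (hmom : (fun h : ℝ => h ^ 1 • ∫ τ in M.I, (M.B τ * M.w τ) • (M.C τ ^ 0 • Y h τ))
      =O[𝓝 0] fun h : ℝ => h ^ (s + 1)) :
    (fun h => v h - (v₀ + h • ∫ τ in M.I, (M.B τ * M.w τ) • (Y h τ + G h τ)))
      =O[𝓝 0] fun h : ℝ => h ^ (s + 1) := by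
  have hG0 : M.DomO ρ 0 G := by simpa using hG 0
  have h1 := hD.isBigO_integral_B_sub_sum (k := p) (N := p) (γ := γ) (F := G)
    (a := fun j h => h ^ j) (ψ := fun j τ => M.C τ ^ j) (c := fun j => 1 / ((j : ℝ) + 1))
    ((hG p).congr (Eventually.of_forall fun h τ _ => by simp only [mul_pow, mul_comm]))
    (fun j hj => hB.integral_pow hj)
  have h2 := (isBigO_refl (fun h : ℝ => h) (𝓝 0)).smul h1
  simp only [smul_eq_mul, ← pow_succ'] at h2
  have h3 := (((hv p).sub h2).trans (isBigO_pow_of_le (m := p + 1) (n := s + 1) (by omega))).sub hmom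
  refine h3.congr' ?_ EventuallyEq.rfl
  filter_upwards [hD.integrable_B_smul hY0, hD.integrable_B_smul hG0] with h iY iG
  simp only [smul_add, pow_zero, one_smul, pow_one]
  rw [integral_add iY iG, smul_sub, Finset.smul_sum]
  have hs : ∑ j ∈ Finset.range p, h • (h ^ j * (1 / ((j : ℝ) + 1))) • γ j
      = ∑ j ∈ Finset.range p, (h ^ (j + 1) / ((j : ℝ) + 1)) • γ j :=
    Finset.sum_congr rfl fun j _ => by rw [smul_smul]; congr 1; ring
  rw [hs]
  module

/-- The weight `1 - C` is the kernel of Taylor's formula for `q`. As it raises degrees by one,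
`B(p)` covers only `p - 1` terms, but the prefactor `h²` restores order `p + 1`. -/
theorem IsDominated.isBigO_position_error (hD : M.IsDominated f t₀ q₀ r ρ)
    {p s : ℕ} (hB : M.AssumptionB p) (hBbar : ∀ τ ∈ M.I, M.Bbar τ = M.B τ * (1 - M.C τ))
    (hsp : s ≤ p) {G Y : ℝ → ℝ → V} {γ : ℕ → V} {y : ℝ → V} {y₀ v₀ : V}
    (hG : ∀ N, M.DomO ρ N fun h τ => G h τ - ∑ j ∈ Finset.range N, (M.C τ * h) ^ j • γ j)
    (hY0 : M.DomO ρ 0 Y)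
    (hy : ∀ N : ℕ, (fun h => y h - (y₀ + h • v₀ + ∑ j ∈ Finset.range N,
        (h ^ (j + 2) / (((j : ℝ) + 1) * ((j : ℝ) + 2))) • γ j))
      =O[𝓝 0] fun h : ℝ => h ^ (N + 2))
    (hmom : ∀ m < 2, (fun h : ℝ => h ^ 2 • ∫ τ in M.I, (M.B τ * M.w τ) • (M.C τ ^ m • Y h τ))
      =O[𝓝 0] fun h : ℝ => h ^ (s + 1)) :
    (fun h => y h - (y₀ + h • v₀ + h ^ 2 • ∫ τ in M.I, (M.Bbar τ * M.w τ) • (Y h τ + G h τ)))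
      =O[𝓝 0] fun h : ℝ => h ^ (s + 1) := by
  have hG0 : M.DomO ρ 0 G := by simpa using hG 0
  have h1C : M.DomO ρ 0 fun _ τ => 1 - M.C τ := (domO_vec (1 : ℝ)).sub hD.one_le hD.domO_C
  have hCG := h1C.smul hG0
  have h1 := hD.isBigO_integral_B_sub_sum (k := p - 1) (N := p - 1) (γ := γ)
    (F := fun h τ => (1 - M.C τ) • G h τ)
    (a := fun j h => h ^ j) (ψ := fun j τ => M.C τ ^ j - M.C τ ^ (j + 1))
    (c := fun j => 1 / (((j : ℝ) + 1) * ((j : ℝ) + 2))) ?_ ?_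
  · have h2 := (isBigO_refl (fun h : ℝ => h ^ 2) (𝓝 0)).smul h1
    simp only [smul_eq_mul, ← pow_add] at h2
    have h3 := ((((hy (p - 1)).trans (isBigO_pow_of_le (n := s + 1) (by omega))).sub
      (h2.trans (isBigO_pow_of_le (n := s + 1) (by omega)))).sub (hmom 0 (by omega))).add
      (hmom 1 (by omega))
    refine h3.congr' ?_ EventuallyEq.rfl
    filter_upwards [hD.integrable_B_smul hY0, hD.integrable_B_smul (hD.domO_C.smul hY0),
      hD.integrable_B_smul hCG] with h iY iCY iG
    simp only [pow_zero, one_smul, pow_one]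
    have hi : ∫ τ in M.I, (M.Bbar τ * M.w τ) • (Y h τ + G h τ)
        = (∫ τ in M.I, (M.B τ * M.w τ) • Y h τ)
          - (∫ τ in M.I, (M.B τ * M.w τ) • (M.C τ • Y h τ))
          + ∫ τ in M.I, (M.B τ * M.w τ) • ((1 - M.C τ) • G h τ) := by
      have e1 := integral_add (iY.sub iCY) iG
      simp only [Pi.sub_apply] at e1
      rw [← integral_sub iY iCY, ← e1]
      refine setIntegral_congr_fun M.measurableSet_I fun τ hτ => ?_
      simp only [hBbar τ hτ]
      module
    rw [hi, smul_sub, Finset.smul_sum]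
    have hs : ∑ j ∈ Finset.range (p - 1),
        h ^ 2 • (h ^ j * (1 / (((j : ℝ) + 1) * ((j : ℝ) + 2)))) • γ j
        = ∑ j ∈ Finset.range (p - 1), (h ^ (j + 2) / (((j : ℝ) + 1) * ((j : ℝ) + 2))) • γ j :=
      Finset.sum_congr rfl fun j _ => by rw [smul_smul]; congr 1; ring
    rw [hs]
    module
  · have h2 := h1C.smul (hG (p - 1))
    rw [zero_add] at h2
    refine h2.congr (Eventually.of_forall fun h τ _ => ?_)
    rw [smul_sub, Finset.smul_sum]
    congr 1
    refine Finset.sum_congr rfl fun j _ => ?_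
    rw [smul_smul]; congr 1; ring
  · intro j hj
    obtain ⟨i1, v1⟩ := hB.integral_pow (m := j) (by omega)
    obtain ⟨i2, v2⟩ := hB.integral_pow (m := j + 1) (by omega)
    simp only [mul_sub]
    refine ⟨i1.sub i2, ?_⟩
    rw [integral_sub i1 i2, v1, v2]
    push_cast
    field_simp
    ring

end Update

theorem DomO.norm (h1 : ∀ τ ∈ M.I, 1 ≤ ρ τ) {V : Type*} [NormedAddCommGroup V] {N : ℕ}
    {F : ℝ → ℝ → V} (hF : M.DomO ρ N F) : M.DomO ρ N fun h τ => ‖F h τ‖ :=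
  DomO.of_bound h1 hF (hF.1.mono fun _ h => h.norm) (K := 1) (n := 0)
    (Eventually.of_forall fun h τ _ => by simp)

theorem domO_zero_of_bound {V : Type*} [NormedAddCommGroup V] (h1 : ∀ τ ∈ M.I, 1 ≤ ρ τ)
    {F : ℝ → ℝ → V}
    (hF : ∀ᶠ h in 𝓝 (0 : ℝ), AEStronglyMeasurable (F h) (volume.restrict M.I)) {K : ℝ} {n : ℕ}
    (hK : ∀ᶠ h in 𝓝 (0 : ℝ), ∀ τ ∈ M.I, ‖F h τ‖ ≤ K * ρ τ ^ n) : M.DomO ρ 0 F :=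
  DomO.of_bound h1 (domO_vec (1 : ℝ)) hF (hK.mono fun h hh τ hτ => by simpa using hh τ hτ)

theorem IsDominated.domO_comp_sub_sum (hD : M.IsDominated f t₀ q₀ r ρ) {V : Type*}
    [NormedAddCommGroup V] [NormedSpace ℝ V] {φ : ℝ → V} {γ : ℕ → V}
    (hφ0 : M.DomO ρ 0 fun h τ => φ (M.C τ * h)) {N : ℕ}
    (hφ : (fun s => φ s - ∑ j ∈ Finset.range N, s ^ j • γ j) =O[𝓝 0] fun s : ℝ => s ^ N) :
    M.DomO ρ N fun h τ => φ (M.C τ * h) - ∑ j ∈ Finset.range N, (M.C τ * h) ^ j • γ j :=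
  hD.domO_comp_of_isBigO hφ (hφ0.sub hD.one_le (DomO.sum hD.one_le _ fun j _ =>
    ((hD.domO_C_mul_pow j).smul (domO_vec (γ j))).mono hD.one_le (Nat.zero_le _)))

/-- The local errors under the simplifying assumptions. -/
theorem IsDominated.isBigO_local_errors (hD : M.IsDominated f t₀ q₀ r ρ) (hf : ContDiff ℝ ∞ f)
    {p e z s : ℕ} (hB : M.AssumptionB p) (hCN : M.AssumptionCN (e + 1))
    (hDN : M.AssumptionDN (z + 1)) (hBbar : ∀ τ ∈ M.I, M.Bbar τ = M.B τ * (1 - M.C τ))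
    (hsp : s ≤ p) (hse : s ≤ 2 * e + 4) (hsz : s ≤ e + z + 2)
    {q'₀ : EuclideanSpace ℝ (Fin d)} {q q' : ℝ → EuclideanSpace ℝ (Fin d)}
    (hq₀ : q t₀ = q₀) (hq'₀ : q' t₀ = q'₀)
    (hq : ∀ᶠ t in 𝓝 t₀, HasDerivAt q (q' t) t ∧ HasDerivAt q' (f (t, q t)) t)
    {Q : ℝ → ℝ → EuclideanSpace ℝ (Fin d)}
    (hQ : ∀ᶠ h in 𝓝 (0 : ℝ),
      M.IsStageSolution f t₀ q₀ q'₀ h (Q h) ∧ ∀ τ ∈ M.I, ‖Q h τ - q₀‖ ≤ r τ) :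
    (fun h : ℝ => q (t₀ + h) - M.stepPosition f t₀ q₀ q'₀ h (Q h))
        =O[𝓝 0] (fun h : ℝ => h ^ (s + 1)) ∧
      (fun h : ℝ => q' (t₀ + h) - M.stepVelocity f t₀ q'₀ h (Q h))
        =O[𝓝 0] (fun h : ℝ => h ^ (s + 1)) := by
  obtain ⟨x, γ, J, hx, ⟨L, hL0, hL⟩, hxq, hGT, hvT, hxT, hJT⟩ := exists_taylor_solution hf hq
  rw [hq₀] at hL hxT
  rw [hq'₀] at hvT hxT
  have hCm : ∀ h : ℝ, Measurable fun τ => M.C τ * h := fun h => M.measurable_C.mul_const h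
  have hxm : ∀ h : ℝ, AEStronglyMeasurable (fun τ => x (M.C τ * h)) (volume.restrict M.I) :=
    fun h => (hx.measurable.comp (hCm h)).aestronglyMeasurable
  have htube : ∀ᶠ h in 𝓝 (0 : ℝ), ∀ τ ∈ M.I,
      |t₀ + M.C τ * h - t₀| ≤ r τ ∧ ‖x (M.C τ * h) - q₀‖ ≤ r τ := by
    filter_upwards [hD.eventually_abs_C_mul_le 1, hD.eventually_abs_C_mul_le L] with h h1 h2 τ hτ
    exact ⟨by simpa using h1 τ hτ, (hL _).trans (h2 τ hτ)⟩
  have hx0 : M.DomO ρ 0 fun h τ => x (M.C τ * h) - q₀ := by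
    refine domO_zero_of_bound hD.one_le (K := 1) (n := 1)
      (Eventually.of_forall fun h => (hxm h).sub aestronglyMeasurable_const) ?_
    filter_upwards [htube] with h hh τ hτ
    rw [one_mul, pow_one]
    exact (hh τ hτ).2.trans (hD.radius_le τ hτ)
  have hG0 : M.DomO ρ 0 fun h τ => f (t₀ + M.C τ * h, x (M.C τ * h)) := by
    obtain ⟨K, n, -, hK⟩ := hD.bound_apply
    refine domO_zero_of_bound hD.one_le (K := K) (n := n)
      (Eventually.of_forall fun h => aestronglyMeasurable_stage hf h (hxm h)) ?_
    filter_upwards [htube] with h hh τ hτ using hK τ hτ _ _ (hh τ hτ).1 (hh τ hτ).2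
  have hJ0 : M.DomO ρ 0 fun h τ => fderivSnd f (t₀ + M.C τ * h, x (M.C τ * h)) := by
    obtain ⟨K, n, -, hK⟩ := hD.bound_fderiv
    refine domO_zero_of_bound hD.one_le (K := K) (n := n) (Eventually.of_forall fun h => ?_) ?_
    · exact hf.fderivSnd.continuous.comp_aestronglyMeasurable
        (((hCm h).const_add t₀).aestronglyMeasurable.prodMk (hxm h))
    · filter_upwards [htube] with h hh τ hτ using hK τ hτ _ _ (hh τ hτ).1 (hh τ hτ).2
  have hG : ∀ N, M.DomO ρ N fun h τ => f (t₀ + M.C τ * h, x (M.C τ * h))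
      - ∑ j ∈ Finset.range N, (M.C τ * h) ^ j • γ j := fun N =>
    hD.domO_comp_sub_sum (φ := fun s => f (t₀ + s, x s)) hG0 (hGT N)
  have hJ : ∀ N, M.DomO ρ N fun h τ => fderivSnd f (t₀ + M.C τ * h, x (M.C τ * h))
      - ∑ j ∈ Finset.range N, (M.C τ * h) ^ j • J j := fun N =>
    hD.domO_comp_sub_sum (φ := fun s => fderivSnd f (t₀ + s, x s)) hJ0 (hJT N)
  set X : ℝ → ℝ → EuclideanSpace ℝ (Fin d) := fun h τ =>
    x (M.C τ * h) - (q₀ + (M.C τ * h) • q'₀) with hXdef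
  have hCh : M.DomO ρ 0 fun h τ => (M.C τ * h) • q'₀ := by
    have := ((hD.domO_C_mul_pow 1).smul (domO_vec q'₀)).mono hD.one_le (Nat.zero_le _)
    simpa using this
  have hX : ∀ N, M.DomO ρ (N + 2) fun h τ => X h τ - ∑ j ∈ Finset.range N,
      ((M.C τ * h) ^ (j + 2) / (((j : ℝ) + 1) * ((j : ℝ) + 2))) • γ j := fun N => by
    refine hD.domO_comp_of_isBigO (R := fun s => x s - (q₀ + s • q'₀) - ∑ j ∈ Finset.range N,
      (s ^ (j + 2) / (((j : ℝ) + 1) * ((j : ℝ) + 2))) • γ j)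
      ((hxT N).congr_left fun s => by abel) ?_
    refine DomO.sub hD.one_le ((hx0.sub hD.one_le hCh).congr
      (Eventually.of_forall fun h τ _ => by abel)) (DomO.sum hD.one_le _ fun j _ => ?_)
    refine (((hD.domO_C_mul_pow (j + 2)).smul (domO_vec ((1 / (((j : ℝ) + 1) * ((j : ℝ) + 2)))
      • γ j))).mono hD.one_le (Nat.zero_le _)).congr (Eventually.of_forall fun h τ _ => ?_)
    rw [smul_smul, mul_one_div]
  set G : ℝ → ℝ → EuclideanSpace ℝ (Fin d) := fun h τ => f (t₀ + M.C τ * h, x (M.C τ * h))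
    with hGdef
  set E : ℝ → ℝ → EuclideanSpace ℝ (Fin d) := fun h τ => Q h τ - x (M.C τ * h) with hEdef
  set Y : ℝ → ℝ → EuclideanSpace ℝ (Fin d) := fun h τ => f (t₀ + M.C τ * h, Q h τ) - G h τ
    with hYdef
  have hE0 : M.DomO ρ 0 E := by
    refine domO_zero_of_bound hD.one_le (K := 2) (n := 1) ?_ ?_
    · filter_upwards [hQ] with h hQ using hQ.1.aestronglyMeasurable.sub (hxm h)
    · filter_upwards [hQ, htube] with h hQ hh τ hτ
      have hr := hD.radius_le τ hτ
      calc ‖E h τ‖ = ‖(Q h τ - q₀) - (x (M.C τ * h) - q₀)‖ := by rw [sub_sub_sub_cancel_right]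
        _ ≤ r τ + r τ := (norm_sub_le _ _).trans (add_le_add (hQ.2 τ hτ) (hh τ hτ).2)
        _ ≤ 2 * ρ τ ^ 1 := by rw [pow_one]; linarith
  have hYm : ∀ᶠ h in 𝓝 (0 : ℝ), AEStronglyMeasurable (Y h) (volume.restrict M.I) := by
    filter_upwards [hQ] with h hQ
    exact (aestronglyMeasurable_stage hf h hQ.1.aestronglyMeasurable).sub
      (aestronglyMeasurable_stage hf h (hxm h))
  have hYE : ∀ k, M.DomO ρ k E → M.DomO ρ k Y := fun k hk => by
    obtain ⟨K, n, -, hK⟩ := hD.lipschitz hf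
    refine DomO.of_bound hD.one_le hk hYm (K := K) (n := n) ?_
    filter_upwards [hQ, htube] with h hQ hh τ hτ
    exact hK τ hτ _ _ _ (hh τ hτ).1 (hh τ hτ).2 (hQ.2 τ hτ)
  have hYG : ∀ h τ, Y h τ + G h τ = f (t₀ + M.C τ * h, Q h τ) := fun h τ => sub_add_cancel _ _
  have hrel : ∀ᶠ h in 𝓝 (0 : ℝ), ∀ τ ∈ M.I,
      E h τ = h ^ 2 • (∫ σ in M.I, (M.Abar τ σ * M.w σ) • (Y h σ + G h σ)) - X h τ := by
    filter_upwards [hQ] with h hQ τ hτ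
    simp only [hYG, hEdef, hXdef]
    rw [hQ.1.stage_eq τ hτ, mul_comm h]
    abel
  have hE := hD.domO_stage_error hCN hG hX hE0 hYE hrel
  have hYexp : M.DomO ρ s fun h τ =>
      Y h τ - ∑ i ∈ Finset.range z, (M.C τ * h) ^ i • J i (E h τ) := by
    obtain ⟨K, n, -, hK⟩ := hD.bound_linearization hf
    have hE2 := (hE.norm hD.one_le).mul (hE.norm hD.one_le)
    -- The quadratic remainder is the source of the bound `2η + 2`.
    have h1 : M.DomO ρ (e + 2 + (e + 2)) fun h τ =>
        Y h τ - fderivSnd f (t₀ + M.C τ * h, x (M.C τ * h)) (E h τ) := by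
      refine DomO.of_bound hD.one_le hE2 (K := K) (n := n) ?_ ?_
      · filter_upwards [hYm, (hJ0.clm_apply hE0).1] with h h1 h2 using h1.sub h2
      · filter_upwards [hQ, htube] with h hQ hh τ hτ
        rw [norm_mul, norm_norm, ← sq]
        exact hK τ hτ _ _ _ (hh τ hτ).1 (hh τ hτ).2 (hQ.2 τ hτ)
    -- Truncating the Jacobian after `z` terms costs `O(h ^ (z + e + 2))`, within `s ≤ e + z + 2`.
    have h2 := (hJ z).clm_apply hE
    refine ((h1.mono hD.one_le (by omega)).add hD.one_le (h2.mono hD.one_le (by omega))).congr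
      (Eventually.of_forall fun h τ _ => ?_)
    simp only [sub_apply, sum_apply, smul_apply]
    abel
  have hY0 := hYE 0 hE0
  have hmom : ∀ m b, m < b → (fun h : ℝ => h ^ b • ∫ τ in M.I, (M.B τ * M.w τ) •
      (M.C τ ^ m • Y h τ)) =O[𝓝 0] fun h : ℝ => h ^ (s + 1) := fun m b hmb =>
    hD.isBigO_moment_of_expansion hE0 hYexp (by omega) fun i =>
      hD.isBigO_moment hB hDN hsp hsz hG hX hE hY0 hYexp hrel (by omega)
  have hqT : ∀ N : ℕ, (fun s => q (t₀ + s) - (q₀ + s • q'₀ + ∑ j ∈ Finset.range N,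
      (s ^ (j + 2) / (((j : ℝ) + 1) * ((j : ℝ) + 2))) • γ j)) =O[𝓝 0] fun s : ℝ => s ^ (N + 2) :=
    fun N => (hxT N).congr' (by filter_upwards [hxq] with s hs; rw [hs]) EventuallyEq.rfl
  refine ⟨(hD.isBigO_position_error (G := G) hB hBbar hsp hG hY0 hqT
    fun m hm => hmom m 2 hm).congr_left fun h => ?_,
    (hD.isBigO_velocity_error (G := G) hB hsp hG hY0 hvT (hmom 0 1 one_pos)).congr_left fun h => ?_⟩
  · simp only [hYG, stepPosition]
  · simp only [hYG, stepVelocity]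

end LocalErrors

end CsRKN

theorem mainTheorem1 (M : CsRKN) (p η ζ : ℕ)
    (hcoeff : Bornology.IsBounded M.I → M.UniformlyIntegrableCoefficients)
    (hB : M.AssumptionB p) (hCN : M.AssumptionCN η) (hDN : M.AssumptionDN ζ)
    (hBbar : ∀ τ ∈ M.I, M.Bbar τ = M.B τ * (1 - M.C τ)) :
    M.HasOrder (min p (min (2 * η + 2) (η + ζ))) := by
  intro d f t₀ q₀ q'₀ q q' r hf hq₀ hq'₀ hq hr
  obtain ⟨ρ, hD⟩ := hr.exists_isDominated hcoeff hf
  -- For `η = 0` this is `CN(1)`, which is vacuous; likewise `DN(1)` for `ζ = 0`.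
  have hCN' : M.AssumptionCN (η - 1 + 1) := fun κ h1 h2 => hCN κ h1 (by omega)
  have hDN' : M.AssumptionDN (ζ - 1 + 1) := fun κ h1 h2 => hDN κ h1 (by omega)
  exact ⟨hD.existsUnique_stage hf q'₀, fun Q hQ => hD.isBigO_local_errors hf hB hCN' hDN' hBbar
    (by omega) (by omega) (by omega) hq₀ hq'₀ hq hQ⟩
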